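/- **Setting.** A cactus is a connected finite multigraph $G=(V,E)$ in which every edge lies in a unique cycle (cycles have length at least two; parallel edges are allowed). Its leaves are its vertices of degree $2$; $T$ denotes the set of leaves. A CacAP instance $(G,L)$ consists of a cactus $G=(V,E)$ and a set $L\subseteq\binom V2$ of links. A solution is a set $F\subseteq L$ such that $(V,E\cup F)$ is $3$-edge-connected, i.e. $|\delta_E(C)|+|\delta_F(C)|\ge 3$ for every $\emptyset\ne C\subsetneq V$; the instance is feasible if it has a solution. It is a Leaf-to-Leaf+ instance with root $r\in V$ if every endpoint of a link is $r$ or a leaf. Let $\mathcal C=\{C\subseteq V\setminus\{r\} : |\delta_E(C)|=2\}$. For $C\in\mathcal C$ let $T_C$ be the set of leaves in $C$ that are endpoints of links with exactly one endpoint in $C$. A link $\{u,v\}\in L$ is bad if $T_C\subseteq\{u,v\}\subseteq C$ for some $C\in\mathcal C$. A link is an in-link if both its endpoints lie in the same connected component of $G-r$, and $M_{\mathrm{in}}$ denotes the set of in-links in $M$. **Lemma.** There is a polynomial-time algorithm that, given a feasible Leaf-to-Leaf+ CacAP instance $(G,L)$ with root $r$ and a matching $M\subseteq L$ all of whose links join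 leaves of $G$ and none of whose links is bad, computes a solution $F\subseteq L$ with $M\subseteq F$ and $$|F|\le |M|+\tfrac12|M_{\mathrm{in}}|+\bigl(|T|-2|M|\bigr).$$ Here the graph and the links are given by lists of edges and links on the vertex set $\{0,\dots,n-1\}$, and the number of steps, on a random access machine with unit-cost addition and subtraction, is at most a fixed polynomial in the number of vertices plus the number of listed edges and links. -/

import Mathlib

/-! ### Multigraphs, cuts, cacti -/

/-- A multigraph with vertex set `V` and edge set `E`; every edge has an unordered pair of ends. -/
structure Multigraph (V E : Type*) where
  ends : E → Sym2 V

/-- The pair `ℓ` crosses (covers) the vertex set `C`: one end lies in `C`, the other one outside. -/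
def Crosses {V : Type*} (C : Finset V) (ℓ : Sym2 V) : Prop :=
  ∃ u ∈ ℓ, ∃ v ∈ ℓ, u ∈ C ∧ v ∉ C

namespace Multigraph

variable {V E : Type*}

/-- Two different vertices are adjacent if some edge joins them. -/
def toSimple (G : Multigraph V E) : SimpleGraph V where
  Adj u v := u ≠ v ∧ ∃ e, G.ends e = s(u, v)
  symm := ⟨fun _ _ h => ⟨h.1.symm, h.2.imp fun _ he => he.trans Sym2.eq_swap⟩⟩
  loopless := ⟨fun _ h => h.1 rfl⟩

open scoped Classical in
/-- `δ_E(C)`: the edges with exactly one end in `C`. -/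
noncomputable def cut [Fintype E] (G : Multigraph V E) (C : Finset V) : Finset E :=
  Finset.univ.filter fun e => Crosses C (G.ends e)

open scoped Classical in
/-- The number of edges at `v` (the graphs considered below have no loops). -/
noncomputable def degree [Fintype E] (G : Multigraph V E) (v : V) : ℕ :=
  (Finset.univ.filter fun e => v ∈ G.ends e).card

/-- `D` is the edge set of a cycle of length `l + 2 ≥ 2`, that is, of a closed walk
`v 0, e 0, v 1, e 1, …, v (l + 1), e (l + 1), v 0` with distinct vertices and distinct edges
(the addition in `Fin (l + 2)` is cyclic). -/
def IsCycle (G : Multigraph V E) (D : Set E) : Prop :=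
  ∃ (l : ℕ) (v : Fin (l + 2) → V) (e : Fin (l + 2) → E),
    Function.Injective v ∧ Function.Injective e ∧
    (∀ i, G.ends (e i) = s(v i, v (i + 1))) ∧ D = Set.range e

/-- A cactus: a connected graph in which every edge lies in a unique cycle. -/
def IsCactus (G : Multigraph V E) : Prop :=
  G.toSimple.Connected ∧ ∀ e, ∃! D : Set E, G.IsCycle D ∧ e ∈ D

/-- The terminals (leaves) of a cactus: the vertices of degree two. -/
noncomputable def leaves [Fintype V] [Fintype E] (G : Multigraph V E) : Finset V :=
  Finset.univ.filter fun v => G.degree v = 2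

end Multigraph

/-! ### Cactus augmentation -/

/-- A graph together with a link set `L` and a vertex chosen as the root. -/
structure RootedAug (V E : Type*) where
  graph : Multigraph V E
  links : Finset (Sym2 V)
  root : V

namespace RootedAug

variable {V E : Type*}

open scoped Classical in
/-- `δ_U(C)` for a set of links `U`. -/
noncomputable def linkCut (U : Finset (Sym2 V)) (C : Finset V) : Finset (Sym2 V) :=
  U.filter fun ℓ => Crosses C ℓ

/-- A CacAP instance: the graph is a cactus and every link joins two different vertices. -/
def IsCacAP (I : RootedAug V E) : Prop :=
  I.graph.IsCactus ∧ ∀ ℓ ∈ I.links, ¬ ℓ.IsDiag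

/-- `F` is a solution: `F ⊆ L`, and adding `F` to the cactus makes it 3-edge-connected. -/
def IsSolution [Fintype V] [Fintype E] (I : RootedAug V E) (F : Finset (Sym2 V)) : Prop :=
  F ⊆ I.links ∧ ∀ C : Finset V, C.Nonempty → C ≠ Finset.univ →
    3 ≤ (I.graph.cut C).card + (linkCut F C).card

/-- Some set of links is a solution. -/
def IsFeasible [Fintype V] [Fintype E] (I : RootedAug V E) : Prop :=
  ∃ F, I.IsSolution F

/-- Leaf-to-leaf+ (with respect to the chosen root): every end of a link is the root or a leaf. -/
def IsLeafToLeafPlus [Fintype V] [Fintype E] (I : RootedAug V E) : Prop :=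
  ∀ ℓ ∈ I.links, ∀ v ∈ ℓ, v = I.root ∨ v ∈ I.graph.leaves

/-- `C` belongs to the family `𝒞` of 2-cuts that do not contain the root. -/
def IsTwoCut [Fintype E] (I : RootedAug V E) (C : Finset V) : Prop :=
  I.root ∉ C ∧ (I.graph.cut C).card = 2

/-- `t ∈ T_C`: `t` is a leaf in `C` that is an end of a link covering `C`. -/
def IsCoveringLeaf [Fintype V] [Fintype E] (I : RootedAug V E) (C : Finset V) (t : V) : Prop :=
  t ∈ I.graph.leaves ∧ t ∈ C ∧ ∃ ℓ ∈ I.links, t ∈ ℓ ∧ Crosses C ℓ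

/-- The link `ℓ` is bad: `T_C ⊆ ℓ ⊆ C` for some 2-cut `C ∈ 𝒞`. -/
def IsBad [Fintype V] [Fintype E] (I : RootedAug V E) (ℓ : Sym2 V) : Prop :=
  ∃ C, I.IsTwoCut C ∧ (∀ t, I.IsCoveringLeaf C t → t ∈ ℓ) ∧ ∀ v ∈ ℓ, v ∈ C

/-- In-links: both ends lie in the same connected component of `G - r`. -/
def IsInLink (I : RootedAug V E) (ℓ : Sym2 V) : Prop :=
  ∃ u v : ({I.root}ᶜ : Set V), ℓ = s(u.1, v.1) ∧
    (I.graph.toSimple.induce ({I.root}ᶜ : Set V)).Reachable u v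

open scoped Classical in
/-- `U_in`: the in-links in `U`. -/
noncomputable def inLinks (I : RootedAug V E) (U : Finset (Sym2 V)) : Finset (Sym2 V) :=
  U.filter fun ℓ => I.IsInLink ℓ

/-- `M ⊆ L` is a matching on the leaves: its links join leaves and are pairwise disjoint. -/
def IsLeafMatching [Fintype V] [Fintype E] (I : RootedAug V E) (M : Finset (Sym2 V)) : Prop :=
  M ⊆ I.links ∧ (∀ ℓ ∈ M, ∀ v ∈ ℓ, v ∈ I.graph.leaves) ∧
    ∀ ℓ ∈ M, ∀ ℓ' ∈ M, ∀ v, v ∈ ℓ → v ∈ ℓ' → ℓ = ℓ'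

end RootedAug

/-! ### Random access machines with a step count

Memory consists of natural-number variables and arrays, with indirect addressing. Only addition and
truncated subtraction are available as unit-cost arithmetic (no multiplication), so that polynomial
time on this machine is polynomial time on a Turing machine. -/

namespace RAM

/-- Memory: variable `x` holds `var x`, cell `i` of array `a` holds `arr a i`. -/
structure Memory where
  var : ℕ → ℕ
  arr : ℕ → ℕ → ℕ

/-- Write `c` into variable `x`. -/
def Memory.setVar (s : Memory) (x c : ℕ) : Memory :=
  { s with var := Function.update s.var x c }

/-- Write `c` into cell `i` of array `a`. -/
def Memory.setArr (s : Memory) (a i c : ℕ) : Memory :=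
  { s with arr := Function.update s.arr a (Function.update (s.arr a) i c) }

/-- Expressions; `get a e` reads the cell of array `a` whose index is the value of `e`. -/
inductive Expr where
  | const (c : ℕ)
  | var (x : ℕ)
  | get (a : ℕ) (e : Expr)
  | add (e f : Expr)
  | sub (e f : Expr)

/-- The value of an expression. -/
def Expr.eval (s : Memory) : Expr → ℕ
  | const c => c
  | var x => s.var x
  | get a e => s.arr a (e.eval s)
  | add e f => e.eval s + f.eval s
  | sub e f => e.eval s - f.eval s

/-- The number of steps needed to evaluate an expression: one for each operation and operand. -/
def Expr.cost : Expr → ℕ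
  | const _ => 1
  | var _ => 1
  | get _ e => e.cost + 1
  | add e f => e.cost + f.cost + 1
  | sub e f => e.cost + f.cost + 1

/-- Programs. The test `e` of `cond` and `loop` means `e ≠ 0`. -/
inductive Prog where
  | skip
  | assign (x : ℕ) (e : Expr)
  | store (a : ℕ) (i e : Expr)
  | seq (c d : Prog)
  | cond (e : Expr) (c d : Prog)
  | loop (e : Expr) (c : Prog)

/-- `Exec c s t s'`: started on the memory `s`, the program `c` halts after exactly `t` steps with
the memory `s'`. -/
inductive Exec : Prog → Memory → ℕ → Memory → Prop
  | skip (s : Memory) : Exec .skip s 1 s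
  | assign (x : ℕ) (e : Expr) (s : Memory) :
      Exec (.assign x e) s (e.cost + 1) (s.setVar x (e.eval s))
  | store (a : ℕ) (i e : Expr) (s : Memory) :
      Exec (.store a i e) s (i.cost + e.cost + 1) (s.setArr a (i.eval s) (e.eval s))
  | seq {c d : Prog} {s s' s'' : Memory} {t t' : ℕ} :
      Exec c s t s' → Exec d s' t' s'' → Exec (.seq c d) s (t + t') s''
  | cond_then {e : Expr} {c d : Prog} {s s' : Memory} {t : ℕ} :
      e.eval s ≠ 0 → Exec c s t s' → Exec (.cond e c d) s (e.cost + 1 + t) s'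
  | cond_else {e : Expr} {c d : Prog} {s s' : Memory} {t : ℕ} :
      e.eval s = 0 → Exec d s t s' → Exec (.cond e c d) s (e.cost + 1 + t) s'
  | loop_stop {e : Expr} {c : Prog} {s : Memory} :
      e.eval s = 0 → Exec (.loop e c) s (e.cost + 1) s
  | loop_step {e : Expr} {c : Prog} {s s' s'' : Memory} {t t' : ℕ} :
      e.eval s ≠ 0 → Exec c s t s' → Exec (.loop e c) s' t' s'' →
      Exec (.loop e c) s (e.cost + 1 + t + t') s''

/-- Programs are deterministic: the number of steps and the final memory are determined. -/
theorem Exec.det {c : Prog} {s s₁ : Memory} {t₁ : ℕ} (h₁ : Exec c s t₁ s₁) :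
    ∀ {t₂ : ℕ} {s₂ : Memory}, Exec c s t₂ s₂ → t₁ = t₂ ∧ s₁ = s₂ := by
  induction h₁ with
  | skip => intro _ _ h; cases h; exact ⟨rfl, rfl⟩
  | assign => intro _ _ h; cases h; exact ⟨rfl, rfl⟩
  | store => intro _ _ h; cases h; exact ⟨rfl, rfl⟩
  | seq _ _ ih ih' =>
    intro _ _ h
    cases h with
    | seq a b =>
      obtain ⟨rfl, rfl⟩ := ih a
      obtain ⟨rfl, rfl⟩ := ih' b
      exact ⟨rfl, rfl⟩
  | cond_then he _ ih =>
    intro _ _ h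
    cases h with
    | cond_then _ a => obtain ⟨rfl, rfl⟩ := ih a; exact ⟨rfl, rfl⟩
    | cond_else he' _ => exact absurd he' he
  | cond_else he _ ih =>
    intro _ _ h
    cases h with
    | cond_then he' _ => exact absurd he he'
    | cond_else _ a => obtain ⟨rfl, rfl⟩ := ih a; exact ⟨rfl, rfl⟩
  | loop_stop he =>
    intro _ _ h
    cases h with
    | loop_stop _ => exact ⟨rfl, rfl⟩
    | loop_step he' _ _ => exact absurd he he'
  | loop_step he _ _ ih ih' =>
    intro _ _ h
    cases h with
    | loop_stop he' => exact absurd he' he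
    | loop_step _ a b =>
      obtain ⟨rfl, rfl⟩ := ih a
      obtain ⟨rfl, rfl⟩ := ih' b
      exact ⟨rfl, rfl⟩

end RAM

/-! ### Inputs and outputs of the algorithm -/

/-- An explicitly given rooted augmentation instance with a marked set of links: the vertices are
`0, …, n - 1`, and the edges and the links are listed by their pairs of ends. -/
structure AugInput where
  n : ℕ
  m : ℕ
  k : ℕ
  edge : Fin m → Fin n × Fin n
  link : Fin k → Fin n × Fin n
  root : Fin n
  marked : Fin k → Bool

namespace AugInput

/-- The `i`-th listed link. -/
def linkAt (I : AugInput) (i : Fin I.k) : Sym2 (Fin I.n) :=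
  s((I.link i).1, (I.link i).2)

/-- The instance that the input describes. -/
def inst (I : AugInput) : RootedAug (Fin I.n) (Fin I.m) where
  graph := { ends := fun e => s((I.edge e).1, (I.edge e).2) }
  links := Finset.univ.image I.linkAt
  root := I.root

/-- The set of marked links. -/
def matching (I : AugInput) : Finset (Sym2 (Fin I.n)) :=
  (Finset.univ.filter fun i => I.marked i = true).image I.linkAt

/-- The size of the input: number of vertices, edges and listed links. -/
def size (I : AugInput) : ℕ := I.n + I.m + I.k

/-- The initial memory. Variables `0, 1, 2, 3` hold `n`, `m`, `k` and the root; arrays `0, 1` list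
the ends of the edges, arrays `2, 3` the ends of the links, and array `4` holds `1` at the marked
links; everything else is `0`. -/
def memory (I : AugInput) : RAM.Memory where
  var
    | 0 => I.n
    | 1 => I.m
    | 2 => I.k
    | 3 => I.root
    | _ => 0
  arr
    | 0, i => if h : i < I.m then (I.edge ⟨i, h⟩).1 else 0
    | 1, i => if h : i < I.m then (I.edge ⟨i, h⟩).2 else 0
    | 2, i => if h : i < I.k then (I.link ⟨i, h⟩).1 else 0
    | 3, i => if h : i < I.k then (I.link ⟨i, h⟩).2 else 0
    | 4, i => if h : i < I.k then (if I.marked ⟨i, h⟩ then 1 else 0) else 0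
    | _, _ => 0

/-- The link set written by a program: the links at which array `5` is nonzero. -/
def output (I : AugInput) (s : RAM.Memory) : Finset (Sym2 (Fin I.n)) :=
  (Finset.univ.filter fun i : Fin I.k => s.arr 5 i ≠ 0).image I.linkAt

end AugInput

/-!
The algorithm is a primal-dual algorithm with reverse deletion for covering an intersecting family
by arcs, that is, by oriented links.

Let `𝒞` be the family of 2-cuts that avoid the root. As all cuts of a cactus have at least two
edges, `𝒞` is intersecting (`RootedAug.isIntersecting_isTwoCut`), and a link set is a solution if
and only if its links cover all of `𝒞`. An arc covers the members of `𝒞` that it leaves; the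
orientations of the links in `M` are available from the start.

In the dual phase an inclusionwise minimal uncovered member `D` of `𝒞` is chosen as long as there is
one, and all arcs leaving `D` are put into use (`Stamped`). Thus no arc leaves two chosen sets, and
two chosen sets are nested or disjoint. In the pruning phase the arcs in use, except those of `M`,
are examined in the reverse order and removed if they are not needed (`Pruned`). Uncrossing the sets
for which two remaining arcs are needed shows that every chosen set keeps at most one arc
(`eq_of_stamp_eq`), so it remains to bound the number of chosen sets
(`RootedAug.two_mul_card_chosen_le`). The leaves from which arcs leave the chosen sets are disjoint
for different sets, and the two ends of a link of `M` are never used by different chosen sets. As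
the links of `M` are not bad, every chosen set uses an unmatched leaf or meets two links of `M`,
which are in-links since a 2-cut induces a connected subgraph. This gives at most
`(|T| - 2|M|) + |M_in| / 2` chosen sets.

For polynomial time, the members of `𝒞` are enumerated as the nonempty vertex sets that two edges
separate from the root (`RootedAug.side`), and the dual phase runs through them in the order of
their sizes. Running times are tracked by `RAM.Prog.timePoly`, a polynomial that can be read off
from a program and is valid as soon as no loop is iterated more often than its argument says.
-/

/-! ### Running time and frame of a program -/

namespace RAM

/-- The variables that a program assigns. -/
def Prog.vars : Prog → List ℕ
  | .skip => []
  | .assign x _ => [x]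
  | .store _ _ _ => []
  | .seq c d => c.vars ++ d.vars
  | .cond _ c d => c.vars ++ d.vars
  | .loop _ c => c.vars

/-- The arrays that a program writes to. -/
def Prog.arrs : Prog → List ℕ
  | .skip => []
  | .assign _ _ => []
  | .store a _ _ => [a]
  | .seq c d => c.arrs ++ d.arrs
  | .cond _ c d => c.arrs ++ d.arrs
  | .loop _ c => c.arrs

/-- A polynomial that bounds the number of steps of a program in terms of a common bound for the
number of iterations of each execution of each of its loops. -/
noncomputable def Prog.timePoly : Prog → Polynomial ℕ
  | .skip => 1
  | .assign _ e => Polynomial.C (e.cost + 1)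
  | .store _ i e => Polynomial.C (i.cost + e.cost + 1)
  | .seq c d => c.timePoly + d.timePoly
  | .cond e c d => Polynomial.C (e.cost + 1) + c.timePoly + d.timePoly
  | .loop e c => (Polynomial.X + 1) * (Polynomial.C (e.cost + 1) + c.timePoly)

/-- The memories `s` and `s'` agree outside the variables `vs` and the arrays `as`. -/
def Frame (vs as : List ℕ) (s s' : Memory) : Prop :=
  (∀ x, x ∉ vs → s'.var x = s.var x) ∧ ∀ a, a ∉ as → s'.arr a = s.arr a

theorem Frame.refl (vs as : List ℕ) (s : Memory) : Frame vs as s s :=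
  ⟨fun _ _ => rfl, fun _ _ => rfl⟩

theorem Frame.trans {vs as : List ℕ} {s s' s'' : Memory} (h : Frame vs as s s')
    (h' : Frame vs as s' s'') : Frame vs as s s'' :=
  ⟨fun x hx => (h'.1 x hx).trans (h.1 x hx), fun a ha => (h'.2 a ha).trans (h.2 a ha)⟩

theorem Frame.mono {vs vs' as as' : List ℕ} {s s' : Memory} (h : Frame vs as s s')
    (hv : vs ⊆ vs') (ha : as ⊆ as') : Frame vs' as' s s' :=
  ⟨fun x hx => h.1 x fun h' => hx (hv h'), fun a h' => h.2 a fun h'' => h' (ha h'')⟩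

@[simp] theorem Memory.setVar_var (s : Memory) (x c y : ℕ) :
    (s.setVar x c).var y = if y = x then c else s.var y := by
  simp [Memory.setVar, Function.update_apply]

@[simp] theorem Memory.setVar_arr (s : Memory) (x c : ℕ) : (s.setVar x c).arr = s.arr := rfl

@[simp] theorem Memory.setArr_var (s : Memory) (a i c : ℕ) : (s.setArr a i c).var = s.var := rfl

@[simp] theorem Memory.setArr_arr (s : Memory) (a i c b j : ℕ) :
    (s.setArr a i c).arr b j = if b = a ∧ j = i then c else s.arr b j := by
  by_cases hb : b = a
  · subst hb; simp [Memory.setArr, Function.update_apply]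
  · simp [Memory.setArr, hb]

theorem Frame.setVar {vs as : List ℕ} {s s' : Memory} {x c : ℕ} (h : Frame vs as s s')
    (hx : x ∈ vs) : Frame vs as s (s'.setVar x c) := by
  refine ⟨fun y hy => ?_, fun a ha => h.2 a ha⟩
  have : y ≠ x := fun e => hy (e ▸ hx)
  simpa [this] using h.1 y hy

theorem Exec.frame {c : Prog} {s s' : Memory} {t : ℕ} (h : Exec c s t s') :
    Frame c.vars c.arrs s s' := by
  induction h with
  | skip => exact Frame.refl _ _ _
  | assign x e s => exact (Frame.refl _ _ _).setVar (by simp [Prog.vars])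
  | store a i e s =>
    refine ⟨fun _ _ => rfl, fun b hb => ?_⟩
    have : b ≠ a := by simpa [Prog.arrs] using hb
    funext j
    simp [this]
  | seq _ _ ih ih' =>
    exact (ih.mono (by simp [Prog.vars]) (by simp [Prog.arrs])).trans
      (ih'.mono (by simp [Prog.vars]) (by simp [Prog.arrs]))
  | cond_then _ _ ih => exact ih.mono (by simp [Prog.vars]) (by simp [Prog.arrs])
  | cond_else _ _ ih => exact ih.mono (by simp [Prog.vars]) (by simp [Prog.arrs])
  | loop_stop _ => exact Frame.refl _ _ _
  | loop_step _ _ _ ih ih' => exact Frame.trans ih ih'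

/-! ### Total correctness with a time bound -/

/-- Started on `s`, the program `c` halts in a memory satisfying `Q`, within the time that
`Prog.timePoly` allows if no loop is iterated more than `N` times in a row. -/
def Runs (N : ℕ) (c : Prog) (s : Memory) (Q : Memory → Prop) : Prop :=
  ∃ t s', Exec c s t s' ∧ t ≤ c.timePoly.eval N ∧ Q s'

namespace Runs

variable {N : ℕ} {c d : Prog} {s : Memory} {Q Q' : Memory → Prop}

theorem mono (h : Runs N c s Q) (hQ : ∀ s', Frame c.vars c.arrs s s' → Q s' → Q' s') :
    Runs N c s Q' := by
  obtain ⟨t, s', he, ht, hs⟩ := h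
  exact ⟨t, s', he, ht, hQ s' he.frame hs⟩

theorem skip (h : Q s) : Runs N .skip s Q :=
  ⟨1, s, .skip s, by simp [Prog.timePoly], h⟩

theorem assign {x : ℕ} {e : Expr} (h : Q (s.setVar x (e.eval s))) : Runs N (.assign x e) s Q :=
  ⟨_, _, .assign x e s, by simp [Prog.timePoly], h⟩

theorem store {a : ℕ} {i e : Expr} (h : Q (s.setArr a (i.eval s) (e.eval s))) :
    Runs N (.store a i e) s Q :=
  ⟨_, _, .store a i e s, by simp [Prog.timePoly], h⟩

theorem seq (h : Runs N c s fun s' => Runs N d s' Q) : Runs N (.seq c d) s Q := by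
  obtain ⟨t, s', he, ht, t', s'', he', ht', hQ⟩ := h
  exact ⟨_, _, .seq he he', by simp [Prog.timePoly]; omega, hQ⟩

/-- Countdown rule: `Inv i` holds when `i` iterations are left. -/
theorem countdown {e : Expr} (Inv : ℕ → Memory → Prop)
    (hval : ∀ i s, Inv i s → e.eval s = i)
    (step : ∀ i s, i < N → Inv (i + 1) s → Runs N c s (Inv i)) {j : ℕ} (hj : j ≤ N)
    (h : Inv j s) : Runs N (.loop e c) s (Inv 0) := by
  suffices ∀ (j : ℕ) (s : Memory), j ≤ N → Inv j s → ∃ t s', Exec (.loop e c) s t s' ∧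
      t ≤ (j + 1) * (e.cost + 1 + c.timePoly.eval N) ∧ Inv 0 s' by
    obtain ⟨t, s', he, ht, hs⟩ := this j s hj h
    refine ⟨t, s', he, ht.trans ?_, hs⟩
    simp only [Prog.timePoly, Polynomial.eval_mul, Polynomial.eval_add, Polynomial.eval_X,
      Polynomial.eval_one, Polynomial.eval_C]
    exact Nat.mul_le_mul_right _ (by omega)
  intro j
  induction j with
  | zero =>
    intro s _ h
    exact ⟨_, s, Exec.loop_stop (hval 0 s h), by rw [Nat.zero_add, Nat.one_mul]; omega, h⟩
  | succ j ih =>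
    intro s hj h
    obtain ⟨t, s', he, ht, hs⟩ := step j s hj h
    obtain ⟨t', s'', he', ht', hs'⟩ := ih s' (by omega) hs
    refine ⟨_, s'', .loop_step (by rw [hval _ s h]; omega) he he', ?_, hs'⟩
    rw [Nat.add_mul (j + 1) 1, Nat.one_mul]
    omega

end Runs

/-- Execute `c` only if the value of `e` is nonzero. -/
def guarded (e : Expr) (c : Prog) : Prog := .cond e c .skip

/-- Execute `c` for `x = 0, 1, …, e - 1`. -/
def forLoop (x : ℕ) (e : Expr) (c : Prog) : Prog :=
  .seq (.assign x (.const 0))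
    (.loop (.sub e (.var x)) (.seq c (.assign x (.add (.var x) (.const 1)))))

namespace Runs

variable {N : ℕ} {c d : Prog} {s : Memory} {Q Q' : Memory → Prop}

theorem guarded {e : Expr} (h : e.eval s ≠ 0 → Runs N c s Q) (h' : e.eval s = 0 → Q s) :
    Runs N (RAM.guarded e c) s Q := by
  by_cases he : e.eval s = 0
  · exact ⟨_, s, .cond_else he (.skip s), by simp [RAM.guarded, Prog.timePoly], h' he⟩
  · obtain ⟨t, s', hx, ht, hQ⟩ := h he
    exact ⟨_, s', .cond_then he hx, by simp [RAM.guarded, Prog.timePoly]; omega, hQ⟩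

/-- Invariant rule for counting loops; what the body does not write keeps its initial value. -/
theorem for_loop {x M : ℕ} {e : Expr} (Inv : ℕ → Memory → Prop) (hM : M ≤ N) (hx : x ∉ c.vars)
    (he : ∀ s', Frame (x :: c.vars) c.arrs s s' → e.eval s' = M)
    (h0 : Inv 0 (s.setVar x 0))
    (step : ∀ i < M, ∀ s', Frame (x :: c.vars) c.arrs s s' → s'.var x = i → Inv i s' →
      Runs N c s' fun s'' => Inv (i + 1) (s''.setVar x (i + 1))) :
    Runs N (forLoop x e c) s (Inv M) := by
  refine seq (assign ?_)
  refine mono (countdown (j := M) (fun j s' => j ≤ M ∧ Frame (x :: c.vars) c.arrs s s' ∧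
    s'.var x = M - j ∧ Inv (M - j) s') ?_ ?_ hM ?_) ?_
  · rintro i s' ⟨hi, hf, hxi, -⟩
    simp only [Expr.eval, he s' hf, hxi]
    omega
  · rintro i s' - ⟨hi, hf, hxi, hinv⟩
    refine seq (mono (step (M - (i + 1)) (by omega) s' hf hxi hinv) fun s'' hf' h => assign ?_)
    have hx' : s''.var x = M - (i + 1) := (hf'.1 x hx).trans hxi
    have : M - i = M - (i + 1) + 1 := by omega
    refine ⟨by omega, Frame.setVar (hf.trans (hf'.mono (by simp) (by simp))) (by simp), ?_, ?_⟩
    · simp [Expr.eval, hx', this]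
    · rw [this]
      simpa [Expr.eval, hx'] using h
  · refine ⟨le_rfl, (Frame.refl _ _ _).setVar (by simp), ?_, ?_⟩
    · simp [Expr.eval]
    · simpa [Expr.eval] using h0
  · rintro s' - ⟨-, -, -, h⟩
    simpa using h

/-- A loop that adds up the values of `g`. -/
theorem for_sum {x y M : ℕ} {e g : Expr} (f : ℕ → ℕ) (hM : M ≤ N) (hxy : x ≠ y)
    (he : ∀ s', Frame [x, y] [] s s' → e.eval s' = M)
    (hg : ∀ i < M, ∀ s', Frame [x, y] [] s s' → s'.var x = i → g.eval s' = f i) :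
    Runs N (forLoop x e (.assign y (.add (.var y) g))) s
      (fun s' => s'.var y = s.var y + ∑ i ∈ Finset.range M, f i) := by
  refine for_loop (fun i s' => s'.var y = s.var y + ∑ j ∈ Finset.range i, f j) hM
    (by simpa [Prog.vars] using hxy) he (by simp [hxy.symm]) ?_
  intro i hi s' hf hxi hinv
  refine assign ?_
  simp [hxy.symm, Expr.eval, hinv, hg i hi s' hf hxi, Finset.sum_range_succ, add_assoc]

end Runs

end RAM

/-! ### Covering an intersecting family by arcs -/

/-- A family of arcs, that is, of ordered pairs of vertices. -/
structure ArcFamily (V A : Type*) where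
  tail : A → V
  head : A → V

namespace ArcFamily

variable {V A : Type*} [DecidableEq V] (𝒜 : ArcFamily V A)

/-- The arc `a` leaves the vertex set `X`. -/
def Leaves (a : A) (X : Finset V) : Prop := 𝒜.tail a ∈ X ∧ 𝒜.head a ∉ X

instance (a : A) (X : Finset V) : Decidable (𝒜.Leaves a X) := by
  unfold Leaves; infer_instance

theorem Leaves.of_inter {𝒜 : ArcFamily V A} {a : A} {X Y : Finset V} (h : 𝒜.Leaves a (X ∩ Y)) :
    𝒜.Leaves a X ∨ 𝒜.Leaves a Y := by
  simp only [Leaves, Finset.mem_inter] at *; tauto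

theorem Leaves.of_union {𝒜 : ArcFamily V A} {a : A} {X Y : Finset V} (h : 𝒜.Leaves a (X ∪ Y)) :
    𝒜.Leaves a X ∨ 𝒜.Leaves a Y := by
  simp only [Leaves, Finset.mem_union] at *; tauto

end ArcFamily

/-- Two members of `𝒞` with a common element have their intersection and their union in `𝒞`. -/
def IsIntersecting {V : Type*} [DecidableEq V] (𝒞 : Finset V → Prop) : Prop :=
  ∀ X Y, 𝒞 X → 𝒞 Y → (X ∩ Y).Nonempty → 𝒞 (X ∩ Y) ∧ 𝒞 (X ∪ Y)

/-- The outcome of the greedy dual phase. Stamp `0` means that an arc is not in use, stamp `1` that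
it is marked, and for `2 ≤ i ≤ q` the arcs with stamp `i` are those that leave the `i`-th chosen set
`D i`. When `D i` was chosen, it was an inclusionwise minimal member of `𝒞` left by no stamped
arc. -/
structure Stamped {V A : Type*} [DecidableEq V] (𝒜 : ArcFamily V A) (𝒞 : Finset V → Prop)
    (marked : A → Prop) (st : A → ℕ) (q : ℕ) (D : ℕ → Finset V) : Prop where
  one_le : 1 ≤ q
  le : ∀ a, st a ≤ q
  eq_one_iff : ∀ a, st a = 1 ↔ marked a
  mem : ∀ i, 2 ≤ i → i ≤ q → 𝒞 (D i)
  eq_iff : ∀ i, 2 ≤ i → i ≤ q → ∀ a, st a = i ↔ 𝒜.Leaves a (D i)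
  minimal : ∀ i, 2 ≤ i → i ≤ q → ∀ C, 𝒞 C → C ⊂ D i → ∃ a, st a ≠ 0 ∧ st a < i ∧ 𝒜.Leaves a C

namespace Stamped

variable {V A : Type*} [DecidableEq V] {𝒜 : ArcFamily V A} {𝒞 : Finset V → Prop}
  {marked : A → Prop} {st : A → ℕ} {q : ℕ} {D : ℕ → Finset V}

theorem initial (h : ∀ a, st a = 0 ∨ st a = 1) (h' : ∀ a, st a = 1 ↔ marked a) :
    Stamped 𝒜 𝒞 marked st 1 D where
  one_le := le_rfl
  le a := by rcases h a with h | h <;> omega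
  eq_one_iff := h'
  mem i hi hi' := by omega
  eq_iff i hi hi' := by omega
  minimal i hi hi' := by omega

/-- Choosing one more set. -/
theorem step (h : Stamped 𝒜 𝒞 marked st q D) {C : Finset V} (hC : 𝒞 C)
    (hno : ∀ a, st a ≠ 0 → ¬ 𝒜.Leaves a C)
    (hmin : ∀ C', 𝒞 C' → C' ⊂ C → ∃ a, st a ≠ 0 ∧ 𝒜.Leaves a C') :
    Stamped 𝒜 𝒞 marked (fun a => if 𝒜.Leaves a C then q + 1 else st a) (q + 1)
      (Function.update D (q + 1) C) := by
  have h1 := h.one_le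
  have hD : ∀ i, i ≤ q → Function.update D (q + 1) C i = D i := fun i hi =>
    Function.update_of_ne (by omega) _ _
  have h0 : ∀ a, 𝒜.Leaves a C → st a = 0 := fun a ha => by
    by_contra hne; exact hno a hne ha
  refine ⟨by omega, fun a => ?_, fun a => ?_, fun i hi hi' => ?_, fun i hi hi' a => ?_,
    fun i hi hi' C' hC' hlt => ?_⟩
  · have := h.le a
    split_ifs <;> omega
  · have := h.eq_one_iff a
    split_ifs with hl
    · rw [← this, h0 a hl]; omega
    · exact this
  · rcases Nat.lt_or_ge q i with hq | hq
    · obtain rfl : i = q + 1 := by omega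
      simpa using hC
    · rw [hD i hq]; exact h.mem i hi hq
  · rcases Nat.lt_or_ge q i with hq | hq
    · obtain rfl : i = q + 1 := by omega
      have := h.le a
      simp only [Function.update_self]
      split_ifs with hl
      · simp [hl]
      · simp only [hl, iff_false]; omega
    · rw [hD i hq, ← h.eq_iff i hi hq a]
      split_ifs with hl
      · rw [h0 a hl]; omega
      · rfl
  · rcases Nat.lt_or_ge q i with hq | hq
    · obtain rfl : i = q + 1 := by omega
      rw [Function.update_self] at hlt
      obtain ⟨a, ha, hl⟩ := hmin C' hC' hlt
      have hn : ¬ 𝒜.Leaves a C := hno a ha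
      have := h.le a
      exact ⟨a, by simpa [hn] using ha, by simp only [hn, if_false]; omega, hl⟩
    · rw [hD i hq] at hlt
      obtain ⟨a, ha, hai, hl⟩ := h.minimal i hi hq C' hC' hlt
      have hn : ¬ 𝒜.Leaves a C := hno a ha
      exact ⟨a, by simpa [hn] using ha, by simpa [hn] using hai, hl⟩

/-- A member of `𝒞` that was still uncovered when `D i` was chosen contains `D i` or is disjoint
from it. -/
theorem subset_of_inter (h : Stamped 𝒜 𝒞 marked st q D) (h𝒞 : IsIntersecting 𝒞) {i : ℕ}
    (hi : 2 ≤ i) (hi' : i ≤ q) {X : Finset V} (hX : 𝒞 X)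
    (hno : ∀ a, st a ≠ 0 → st a < i → ¬ 𝒜.Leaves a X) (hne : (X ∩ D i).Nonempty) : D i ⊆ X := by
  by_contra hsub
  have hlt : X ∩ D i ⊂ D i :=
    Finset.inter_subset_right.ssubset_of_ne fun e => hsub (Finset.inter_eq_right.1 e)
  obtain ⟨a, ha, hai, hl⟩ := h.minimal i hi hi' _ (h𝒞 X _ hX (h.mem i hi hi') hne).1 hlt
  rcases hl.of_inter with hl | hl
  · exact hno a ha hai hl
  · have := (h.eq_iff i hi hi' a).2 hl
    omega

/-- No arc leaving a chosen set starts in a set chosen before: the chosen sets are nested or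
disjoint, and an arc leaving the larger of two nested sets would also leave the smaller one. -/
theorem tail_not_mem (h : Stamped 𝒜 𝒞 marked st q D) (h𝒞 : IsIntersecting 𝒞) {i j : ℕ}
    (hi : 2 ≤ i) (hij : i < j) (hj : j ≤ q) {a : A} (ha : 𝒜.Leaves a (D j)) :
    𝒜.tail a ∉ D i := by
  intro hmem
  have hsub : D i ⊆ D j := by
    refine h.subset_of_inter h𝒞 hi (by omega) (h.mem j (by omega) hj) (fun b _ hb hl => ?_)
      ⟨_, Finset.mem_inter.2 ⟨ha.1, hmem⟩⟩
    have := (h.eq_iff j (by omega) hj b).2 hl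
    omega
  have h1 := (h.eq_iff j (by omega) hj a).2 ha
  have h2 := (h.eq_iff i hi (by omega) a).2 ⟨hmem, fun hh => ha.2 (hsub hh)⟩
  omega

end Stamped

/-- If the arc `a` is still in use for the stamps `st`, then some member `X` of `𝒞` shows that it
is needed: no other arc in use leaves `X`, nor does any arc with a smaller original stamp. -/
def Settled {V A : Type*} [DecidableEq V] (𝒜 : ArcFamily V A) (𝒞 : Finset V → Prop)
    (st₀ st : A → ℕ) (a : A) : Prop :=
  st a ≠ 0 → ∃ X, 𝒞 X ∧ 𝒜.Leaves a X ∧ (∀ b, b ≠ a → st b ≠ 0 → ¬ 𝒜.Leaves b X) ∧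
    ∀ b, st₀ b ≠ 0 → st₀ b < st₀ a → ¬ 𝒜.Leaves b X

section Pruning

variable {V A : Type*} [DecidableEq V] {𝒜 : ArcFamily V A} {𝒞 : Finset V → Prop}
  {marked : A → Prop} {st₀ st : A → ℕ} {q : ℕ} {D : ℕ → Finset V}

theorem Settled.anti {st' : A → ℕ} {a : A} (h : Settled 𝒜 𝒞 st₀ st a)
    (hle : ∀ b, st' b ≠ 0 → st b ≠ 0) : Settled 𝒜 𝒞 st₀ st' a := by
  intro ha
  obtain ⟨X, hX, hl, h1, h2⟩ := h (hle a ha)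
  exact ⟨X, hX, hl, fun b hb hb' => h1 b hb (hle b hb'), h2⟩

/-- After pruning, at most one arc of every stamp `≥ 2` is left. If there were two, their
witnesses `X` and `Y` would both contain `D i`, so that each arc ends in the witness of the other
one, and `X ∪ Y` would not be covered. -/
theorem eq_of_stamp_eq (h : Stamped 𝒜 𝒞 marked st₀ q D) (h𝒞 : IsIntersecting 𝒞)
    (hsub : ∀ a, st a = 0 ∨ st a = st₀ a)
    (hcov : ∀ X, 𝒞 X → ∃ a, st a ≠ 0 ∧ 𝒜.Leaves a X)
    (hset : ∀ a, 2 ≤ st₀ a → Settled 𝒜 𝒞 st₀ st a) {a b : A} (ha : 2 ≤ st a)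
    (hab : st a = st b) : a = b := by
  by_contra hne
  have ha₀ : st₀ a = st a := by rcases hsub a with h | h <;> omega
  have hb₀ : st₀ b = st a := by rcases hsub b with h | h <;> omega
  obtain ⟨X, hX, haX, hX1, hX2⟩ := hset a (by omega) (by omega)
  obtain ⟨Y, hY, hbY, hY1, hY2⟩ := hset b (by omega) (by omega)
  have hq : st a ≤ q := ha₀ ▸ h.le a
  have haD := (h.eq_iff _ ha hq a).1 ha₀
  have hbD := (h.eq_iff _ ha hq b).1 hb₀
  have hDX : D (st a) ⊆ X := h.subset_of_inter h𝒞 ha hq hX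
    (fun c hc hc' => hX2 c hc (by omega)) ⟨_, Finset.mem_inter.2 ⟨haX.1, haD.1⟩⟩
  have hDY : D (st a) ⊆ Y := h.subset_of_inter h𝒞 ha hq hY
    (fun c hc hc' => hY2 c hc (by omega)) ⟨_, Finset.mem_inter.2 ⟨hbY.1, hbD.1⟩⟩
  have hbX : 𝒜.head b ∈ X := by
    by_contra hh
    exact hX1 b (Ne.symm hne) (by omega) ⟨hDX hbD.1, hh⟩
  have haY : 𝒜.head a ∈ Y := by
    by_contra hh
    exact hY1 a hne (by omega) ⟨hDY haD.1, hh⟩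
  obtain ⟨c, hc, hl⟩ :=
    hcov _ (h𝒞 X Y hX hY ⟨_, Finset.mem_inter.2 ⟨hDX haD.1, hDY haD.1⟩⟩).2
  rcases hl.of_union with hl' | hl'
  · obtain rfl : c = a := by by_contra hca; exact hX1 c hca hc hl'
    exact hl.2 (Finset.mem_union_right _ haY)
  · obtain rfl : c = b := by by_contra hcb; exact hY1 c hcb hc hl'
    exact hl.2 (Finset.mem_union_left _ hbX)

theorem card_pruned_le [Fintype A] (h : Stamped 𝒜 𝒞 marked st₀ q D) (h𝒞 : IsIntersecting 𝒞)
    (hsub : ∀ a, st a = 0 ∨ st a = st₀ a)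
    (hcov : ∀ X, 𝒞 X → ∃ a, st a ≠ 0 ∧ 𝒜.Leaves a X)
    (hset : ∀ a, 2 ≤ st₀ a → Settled 𝒜 𝒞 st₀ st a) :
    (Finset.univ.filter fun a => 2 ≤ st a).card ≤ (Finset.Icc 2 q).card := by
  refine Finset.card_le_card_of_injOn st (fun a ha => ?_) fun a ha b _ hab => ?_
  · have ha : 2 ≤ st a := by simpa using ha
    have := h.le a
    rcases hsub a with h | h <;> simp <;> omega
  · exact eq_of_stamp_eq h h𝒞 hsub hcov hset (by simpa using ha) hab

end Pruning

/-- Double counting: elements of `U` pay two units, elements of `W` pay one. -/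
theorem two_mul_card_le_of_disjoint {V Y : Type*} [DecidableEq V] [DecidableEq Y] {J : Finset ℕ}
    {U : Finset V} {W : Finset Y} {T : ℕ → Finset V} {S : ℕ → Finset Y}
    (hTU : ∀ i ∈ J, T i ⊆ U) (hSW : ∀ i ∈ J, S i ⊆ W)
    (hT : ∀ i ∈ J, ∀ j ∈ J, i < j → Disjoint (T i) (T j))
    (hS : ∀ i ∈ J, ∀ j ∈ J, i < j → Disjoint (S i) (S j))
    (h : ∀ i ∈ J, 2 ≤ 2 * (T i).card + (S i).card) : 2 * J.card ≤ 2 * U.card + W.card := by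
  have hT' : ∑ i ∈ J, (T i).card ≤ U.card := by
    rw [← Finset.card_biUnion]
    · exact Finset.card_le_card (Finset.biUnion_subset.2 hTU)
    · intro i hi j hj hij
      rcases lt_or_gt_of_ne hij with h | h
      · exact hT i hi j hj h
      · exact (hT j hj i hi h).symm
  have hS' : ∑ i ∈ J, (S i).card ≤ W.card := by
    rw [← Finset.card_biUnion]
    · exact Finset.card_le_card (Finset.biUnion_subset.2 hSW)
    · intro i hi j hj hij
      rcases lt_or_gt_of_ne hij with h | h
      · exact hS i hi j hj h
      · exact (hS j hj i hi h).symm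
  calc 2 * J.card = ∑ i ∈ J, 2 := by simp [mul_comm]
    _ ≤ ∑ i ∈ J, (2 * (T i).card + (S i).card) := Finset.sum_le_sum h
    _ = 2 * ∑ i ∈ J, (T i).card + ∑ i ∈ J, (S i).card := by
      rw [Finset.sum_add_distrib, Finset.mul_sum]
    _ ≤ _ := by omega

/-- The invariant of the pruning phase, once the arcs in `P` have been examined. -/
structure Pruned {V A : Type*} [DecidableEq V] (𝒜 : ArcFamily V A) (𝒞 : Finset V → Prop)
    (st₀ st : A → ℕ) (P : Set A) : Prop where
  sub : ∀ a, st a = 0 ∨ st a = st₀ a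
  cover : ∀ X, 𝒞 X → ∃ a, st a ≠ 0 ∧ 𝒜.Leaves a X
  settled : ∀ a ∈ P, Settled 𝒜 𝒞 st₀ st a
  eq : ∀ a, a ∉ P → st a = st₀ a

namespace Pruned

variable {V A : Type*} [DecidableEq V] [DecidableEq A] {𝒜 : ArcFamily V A} {𝒞 : Finset V → Prop}
  {st₀ st : A → ℕ} {P : Set A} {a : A}

theorem drop (h : Pruned 𝒜 𝒞 st₀ st P)
    (hcov : ∀ X, 𝒞 X → ∃ b, Function.update st a 0 b ≠ 0 ∧ 𝒜.Leaves b X) :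
    Pruned 𝒜 𝒞 st₀ (Function.update st a 0) (insert a P) := by
  refine ⟨fun b => ?_, hcov, fun b hb => ?_, fun b hb => ?_⟩
  · rcases eq_or_ne b a with rfl | hb
    · simp
    · simpa [hb] using h.sub b
  · rcases eq_or_ne b a with rfl | hba
    · exact fun hh => absurd (by simp) hh
    · refine (h.settled b (hb.resolve_left hba)).anti fun c hc => ?_
      rcases eq_or_ne c a with rfl | hc'
      · simp at hc
      · simpa [hc'] using hc
  · rw [Set.mem_insert_iff, not_or] at hb
    simpa [hb.1] using h.eq b hb.2

theorem keep (h : Pruned 𝒜 𝒞 st₀ st P) (hlt : ∀ b ∈ P, st₀ a ≤ st₀ b)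
    (hcov : ¬ ∀ X, 𝒞 X → ∃ b, Function.update st a 0 b ≠ 0 ∧ 𝒜.Leaves b X) :
    Pruned 𝒜 𝒞 st₀ st (insert a P) := by
  refine ⟨h.sub, h.cover, fun b hb => ?_, fun b hb => h.eq b fun hb' => hb (.inr hb')⟩
  rcases hb with rfl | hb
  · intro _
    push Not at hcov
    obtain ⟨X, hX, hno⟩ := hcov
    have hno' : ∀ c, c ≠ b → st c ≠ 0 → ¬ 𝒜.Leaves c X := fun c hcb hc =>
      hno c (by simpa [hcb] using hc)
    refine ⟨X, hX, ?_, hno', fun c hc hcb => ?_⟩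
    · obtain ⟨c, hc, hl⟩ := h.cover X hX
      by_contra hbl
      exact hno' c (fun e => hbl (e ▸ hl)) hc hl
    · refine hno' c (fun e => by subst e; omega) ?_
      rw [h.eq c fun hcP => by have := hlt c hcP; omega]
      exact hc
  · exact h.settled b hb

end Pruned

/-! ### Cuts of a cactus -/

theorem crosses_mk {V : Type*} {C : Finset V} {a b : V} :
    Crosses C s(a, b) ↔ (a ∈ C ∧ b ∉ C) ∨ (b ∈ C ∧ a ∉ C) := by
  simp only [Crosses, Sym2.mem_iff]
  constructor
  · rintro ⟨u, rfl | rfl, v, rfl | rfl, hu, hv⟩ <;> tauto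
  · rintro (⟨h, h'⟩ | ⟨h, h'⟩)
    · exact ⟨a, .inl rfl, b, .inr rfl, h, h'⟩
    · exact ⟨b, .inr rfl, a, .inl rfl, h, h'⟩

namespace Multigraph

variable {V E : Type*} [Fintype E] {G : Multigraph V E}

theorem mem_cut {C : Finset V} {e : E} : e ∈ G.cut C ↔ Crosses C (G.ends e) := by
  simp [cut]

/-- A cycle does not cross a cut in exactly one edge, since the changes of the indicator function
of the cut along the cycle add up to zero. -/
theorem IsCycle.exists_ne_mem_cut {D : Set E} (hD : G.IsCycle D) {C : Finset V} {e : E}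
    (he : e ∈ D) (heC : e ∈ G.cut C) : ∃ f ∈ G.cut C, f ≠ e := by
  classical
  obtain ⟨l, v, d, -, hd, hends, rfl⟩ := hD
  obtain ⟨i, rfl⟩ := he
  by_contra! hcon
  let χ : Fin (l + 2) → ℤ := fun j => if v j ∈ C then 1 else 0
  have h0 : ∑ j, (χ (j + 1) - χ j) = 0 := by
    rw [Finset.sum_sub_distrib, sub_eq_zero]
    exact Equiv.sum_comp (Equiv.addRight (1 : Fin (l + 2))) χ
  rw [Finset.sum_eq_single i] at h0
  · rw [mem_cut, hends, crosses_mk] at heC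
    simp only [χ] at h0
    rcases heC with ⟨h, h'⟩ | ⟨h, h'⟩ <;> simp [h, h'] at h0
  · intro j _ hj
    have hn : d j ∉ G.cut C := fun hm => hj (hd (hcon _ hm))
    rw [mem_cut, hends, crosses_mk] at hn
    simp only [χ]
    by_cases h : v j ∈ C <;> by_cases h' : v (j + 1) ∈ C <;> simp [h, h'] <;> tauto
  · simp

theorem IsCactus.two_le_card_cut [Fintype V] (hG : G.IsCactus) {C : Finset V} (hC : C.Nonempty)
    (hC' : C ≠ Finset.univ) : 2 ≤ (G.cut C).card := by
  obtain ⟨u, hu⟩ := hC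
  obtain ⟨v, hv⟩ : ∃ v, v ∉ C := by
    by_contra! h
    exact hC' (Finset.eq_univ_iff_forall.2 h)
  obtain ⟨w⟩ := hG.1.preconnected u v
  obtain ⟨d, -, hd, hd'⟩ := w.exists_boundary_dart (C : Set V) hu hv
  obtain ⟨-, e, he⟩ := d.adj
  have heC : e ∈ G.cut C := by
    rw [mem_cut, he, crosses_mk]
    exact .inl ⟨hd, hd'⟩
  obtain ⟨D, ⟨hD, heD⟩, -⟩ := hG.2 e
  obtain ⟨f, hf, hne⟩ := hD.exists_ne_mem_cut heD heC
  exact Finset.one_lt_card.2 ⟨f, hf, e, heC, hne⟩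

/-- The cut function is submodular. -/
theorem card_cut_inter_add_card_cut_union_le [DecidableEq V] (X Y : Finset V) :
    (G.cut (X ∩ Y)).card + (G.cut (X ∪ Y)).card ≤ (G.cut X).card + (G.cut Y).card := by
  classical
  rw [← Finset.card_union_add_card_inter, ← Finset.card_union_add_card_inter (G.cut X)]
  refine Nat.add_le_add (Finset.card_le_card ?_) (Finset.card_le_card ?_)
  all_goals
    intro e
    simp only [Finset.mem_union, Finset.mem_inter, mem_cut]
    induction G.ends e using Sym2.ind with
    | _ a b =>
      simp only [crosses_mk, Finset.mem_union, Finset.mem_inter]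
      tauto

theorem cut_sdiff_subset [DecidableEq V] [DecidableEq E] (X Y : Finset V) :
    G.cut (X \ Y) ⊆ G.cut X ∪ G.cut Y := by
  intro e
  simp only [Finset.mem_union, mem_cut]
  induction G.ends e using Sym2.ind with
  | _ a b =>
    simp only [crosses_mk, Finset.mem_sdiff]
    tauto

theorem cut_compl [Fintype V] [DecidableEq V] (X : Finset V) : G.cut Xᶜ = G.cut X := by
  ext e
  simp only [mem_cut]
  induction G.ends e using Sym2.ind with
  | _ a b =>
    simp only [crosses_mk, Finset.mem_compl]
    tauto

end Multigraph

namespace RootedAug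

variable {V E : Type*} [Fintype V] [Fintype E] {I : RootedAug V E}

open Multigraph

omit [Fintype V] in
theorem IsTwoCut.nonempty {C : Finset V} (hC : I.IsTwoCut C) : C.Nonempty := by
  rw [Finset.nonempty_iff_ne_empty]
  rintro rfl
  have := hC.2
  simp [cut, Crosses] at this

omit [Fintype E] in
theorem ne_univ_of_root_not_mem {C : Finset V} (h : I.root ∉ C) : C ≠ Finset.univ := by
  rintro rfl
  exact h (Finset.mem_univ _)

theorem isIntersecting_isTwoCut [DecidableEq V] (hG : I.graph.IsCactus) :
    IsIntersecting I.IsTwoCut := by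
  intro X Y hX hY hne
  have h1 : I.root ∉ X ∩ Y := fun h => hX.1 (Finset.mem_inter.1 h).1
  have h2 : I.root ∉ X ∪ Y := by
    simp [hX.1, hY.1]
  have h3 := hG.two_le_card_cut hne (ne_univ_of_root_not_mem h1)
  have h4 := hG.two_le_card_cut (hX.nonempty.mono Finset.subset_union_left)
    (ne_univ_of_root_not_mem h2)
  have h5 := card_cut_inter_add_card_cut_union_le (G := I.graph) X Y
  have h6 := hX.2
  have h7 := hY.2
  exact ⟨⟨h1, by omega⟩, ⟨h2, by omega⟩⟩

/-- A 2-cut cannot be split without using an edge inside it: otherwise both edges of the cut would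
have an end in each of the two parts. -/
theorem IsTwoCut.eq_of_cut_subset [DecidableEq V] (hG : I.graph.IsCactus) {D K : Finset V}
    (hD : I.IsTwoCut D) (hK : K.Nonempty) (hKD : K ⊆ D) (hcut : I.graph.cut K ⊆ I.graph.cut D) :
    K = D := by
  classical
  by_contra hne
  have hne' : (D \ K).Nonempty := by
    rw [Finset.sdiff_nonempty]
    exact fun h => hne (hKD.antisymm h)
  have h1 : I.graph.cut (D \ K) ⊆ I.graph.cut D :=
    (cut_sdiff_subset D K).trans (Finset.union_subset subset_rfl hcut)
  have e1 : I.graph.cut K = I.graph.cut D := by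
    refine Finset.eq_of_subset_of_card_le hcut ?_
    rw [hD.2]
    exact hG.two_le_card_cut hK (ne_univ_of_root_not_mem fun h => hD.1 (hKD h))
  have e2 : I.graph.cut (D \ K) = I.graph.cut D := by
    refine Finset.eq_of_subset_of_card_le h1 ?_
    rw [hD.2]
    exact hG.two_le_card_cut hne'
      (ne_univ_of_root_not_mem fun h => hD.1 (Finset.mem_sdiff.1 h).1)
  obtain ⟨e, he⟩ : (I.graph.cut D).Nonempty := by
    rw [← Finset.card_pos, hD.2]; omega
  have he1 := he
  have he2 := he
  rw [← e1] at he1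
  rw [← e2] at he2
  simp only [mem_cut] at he he1 he2
  revert he he1 he2
  induction I.graph.ends e using Sym2.ind with
  | _ a b =>
    simp only [crosses_mk, Finset.mem_sdiff]
    have ha := @hKD a
    have hb := @hKD b
    tauto

/-- A 2-cut avoiding the root induces a connected subgraph: the component of `u` in it is entered by
no edge from the rest of the 2-cut. -/
theorem IsTwoCut.isInLink (hG : I.graph.IsCactus) {D : Finset V} (hD : I.IsTwoCut D) {u v : V}
    (hu : u ∈ D) (hv : v ∈ D) : I.IsInLink s(u, v) := by
  classical
  have hr : ∀ x ∈ D, x ∈ ({I.root}ᶜ : Set V) := fun x hx h => hD.1 (h ▸ hx)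
  let H := I.graph.toSimple.induce ({I.root}ᶜ : Set V)
  let K : Finset V := D.filter fun x => ∃ hx : x ∈ D, H.Reachable ⟨u, hr u hu⟩ ⟨x, hr x hx⟩
  have huK : u ∈ K := Finset.mem_filter.2 ⟨hu, hu, .rfl⟩
  have hstep : ∀ a b, a ∈ K → b ∈ D → ∀ e, I.graph.ends e = s(a, b) → b ∈ K := by
    intro a b ha hb e he
    obtain ⟨haD, _, hra⟩ := Finset.mem_filter.1 ha
    by_cases hab : a = b
    · exact hab ▸ ha
    · refine Finset.mem_filter.2 ⟨hb, hb, hra.trans (SimpleGraph.Adj.reachable ?_)⟩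
      exact ⟨hab, e, he⟩
  have hKD : K = D := by
    refine hD.eq_of_cut_subset hG ⟨u, huK⟩ (Finset.filter_subset _ _) fun e he => ?_
    rw [mem_cut] at he ⊢
    obtain ⟨a, b, hab⟩ : ∃ a b, I.graph.ends e = s(a, b) :=
      Sym2.ind (fun a b => ⟨a, b, rfl⟩) (I.graph.ends e)
    rw [hab, crosses_mk] at he ⊢
    have sub : K ⊆ D := Finset.filter_subset _ _
    rcases he with ⟨h, h'⟩ | ⟨h, h'⟩
    · exact .inl ⟨sub h, fun hb => h' (hstep a b h hb e hab)⟩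
    · exact .inr ⟨sub h, fun hb => h' (hstep b a h hb e (hab.trans Sym2.eq_swap))⟩
  rw [← hKD] at hv
  obtain ⟨-, hvD, h⟩ := Finset.mem_filter.1 hv
  exact ⟨_, _, rfl, h⟩

open scoped Classical in
/-- The vertices that the edges `e` and `f` separate from the root, described as the union of all
vertex sets without the root that are only entered by `e` and `f`. -/
noncomputable def side (I : RootedAug V E) (e f : E) : Finset V :=
  Finset.univ.filter fun v => ∃ C : Finset V, v ∈ C ∧ I.root ∉ C ∧ I.graph.cut C ⊆ {e, f}

theorem mem_side [DecidableEq E] {e f : E} {v : V} :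
    v ∈ I.side e f ↔ ∃ C : Finset V, v ∈ C ∧ I.root ∉ C ∧ I.graph.cut C ⊆ {e, f} := by
  simp only [side, Finset.mem_filter, Finset.mem_univ, true_and]
  convert Iff.rfl

theorem root_not_mem_side {e f : E} : I.root ∉ I.side e f := by
  classical
  rw [mem_side]
  rintro ⟨C, h, h', -⟩
  exact h' h

theorem mem_side_iff_of_ends {e f g : E} {a b : V} (hg : I.graph.ends g = s(a, b)) (he : g ≠ e)
    (hf : g ≠ f) : a ∈ I.side e f ↔ b ∈ I.side e f := by
  classical
  have key : ∀ C : Finset V, I.graph.cut C ⊆ {e, f} → (a ∈ C ↔ b ∈ C) := by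
    intro C hC
    have hn : g ∉ I.graph.cut C := fun h => by
      have := hC h
      simp [he, hf] at this
    rw [mem_cut, hg, crosses_mk] at hn
    tauto
  simp only [mem_side]
  constructor
  · rintro ⟨C, h, h1, h2⟩; exact ⟨C, (key C h2).1 h, h1, h2⟩
  · rintro ⟨C, h, h1, h2⟩; exact ⟨C, (key C h2).2 h, h1, h2⟩

theorem cut_side_subset [DecidableEq E] {e f : E} : I.graph.cut (I.side e f) ⊆ {e, f} := by
  intro g hg
  by_contra hn
  simp only [Finset.mem_insert, Finset.mem_singleton, not_or] at hn
  obtain ⟨a, b, hab⟩ : ∃ a b, I.graph.ends g = s(a, b) :=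
    Sym2.ind (fun a b => ⟨a, b, rfl⟩) (I.graph.ends g)
  have := mem_side_iff_of_ends hab hn.1 hn.2
  rw [mem_cut, hab, crosses_mk] at hg
  tauto

theorem isTwoCut_side (hG : I.graph.IsCactus) {e f : E} (hne : (I.side e f).Nonempty) :
    I.IsTwoCut (I.side e f) := by
  classical
  exact ⟨root_not_mem_side, ((Finset.card_le_card cut_side_subset).trans
    Finset.card_le_two).antisymm
    (hG.two_le_card_cut hne (ne_univ_of_root_not_mem root_not_mem_side))⟩

theorem IsTwoCut.exists_eq_side (hG : I.graph.IsCactus) {C : Finset V} (hC : I.IsTwoCut C) :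
    ∃ e f, C = I.side e f := by
  classical
  obtain ⟨e, f, -, hef⟩ := Finset.card_eq_two.1 hC.2
  have hsub : C ⊆ I.side e f := fun v hv => mem_side.2 ⟨C, hv, hC.1, hef.subset⟩
  have hS := isTwoCut_side hG (hC.nonempty.mono hsub)
  refine ⟨e, f, hS.eq_of_cut_subset hG hC.nonempty hsub fun g hg => ?_⟩
  have heq : I.graph.cut (I.side e f) = {e, f} :=
    Finset.eq_of_subset_of_card_le cut_side_subset (hS.2.symm ▸ Finset.card_le_two)
  rw [heq, ← hef]
  exact hg

/-! ### The size of the augmentation -/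

theorem exists_cross_of_isFeasible (hf : I.IsFeasible) {C : Finset V} (hC : I.IsTwoCut C) :
    ∃ ℓ ∈ I.links, Crosses C ℓ := by
  obtain ⟨F, hF, h⟩ := hf
  classical
  have := h C hC.nonempty (ne_univ_of_root_not_mem hC.1)
  rw [hC.2] at this
  obtain ⟨ℓ, hℓ⟩ : (linkCut F C).Nonempty := by rw [← Finset.card_pos]; omega
  simp only [linkCut, Finset.mem_filter] at hℓ
  obtain ⟨h1, h2⟩ := hℓ
  exact ⟨ℓ, hF h1, h2⟩

theorem isSolution_of_cross (hG : I.graph.IsCactus) {F : Finset (Sym2 V)} (hF : F ⊆ I.links)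
    (h : ∀ C, I.IsTwoCut C → ∃ ℓ ∈ F, Crosses C ℓ) : I.IsSolution F := by
  classical
  have key : ∀ C : Finset V, C.Nonempty → I.root ∉ C →
      3 ≤ (I.graph.cut C).card + (linkCut F C).card := by
    intro C hC hr
    have h2 := hG.two_le_card_cut hC (ne_univ_of_root_not_mem hr)
    rcases h2.eq_or_lt with h2 | h2
    · obtain ⟨ℓ, hℓ, hc⟩ := h C ⟨hr, h2.symm⟩
      have hm : ℓ ∈ linkCut F C := by
        simp only [linkCut, Finset.mem_filter]
        exact ⟨hℓ, hc⟩
      have : 0 < (linkCut F C).card := Finset.card_pos.2 ⟨ℓ, hm⟩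
      omega
    · omega
  refine ⟨hF, fun C hC hC' => ?_⟩
  by_cases hr : I.root ∈ C
  · have := key Cᶜ (by rwa [Finset.nonempty_iff_ne_empty, Ne, Finset.compl_eq_empty_iff])
      (by simpa using hr)
    rw [cut_compl] at this
    have hl : linkCut F Cᶜ = linkCut F C := by
      ext ℓ
      simp only [linkCut, Finset.mem_filter]
      refine and_congr_right fun _ => ?_
      induction ℓ using Sym2.ind with
      | _ a b =>
        simp only [crosses_mk, Finset.mem_compl]
        tauto
    rwa [hl] at this
  · exact key C hC hr

theorem card_unmatched_add_le [DecidableEq V] {T : Finset V} {M : Finset (Sym2 V)}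
    (hd : ∀ ℓ ∈ M, ¬ ℓ.IsDiag) (hT : ∀ ℓ ∈ M, ∀ v ∈ ℓ, v ∈ T)
    (hM : ∀ ℓ ∈ M, ∀ ℓ' ∈ M, ∀ v, v ∈ ℓ → v ∈ ℓ' → ℓ = ℓ') :
    (T.filter fun v => ∀ ℓ ∈ M, v ∉ ℓ).card + 2 * M.card ≤ T.card := by
  have h1 : (M.biUnion Sym2.toFinset).card = 2 * M.card := by
    rw [Finset.card_biUnion]
    · rw [Finset.sum_congr rfl fun ℓ hℓ => Sym2.card_toFinset_of_not_isDiag ℓ (hd ℓ hℓ)]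
      simp [mul_comm]
    · intro ℓ hℓ ℓ' hℓ' hne
      refine Finset.disjoint_left.2 fun v hv hv' => ?_
      exact hne (hM ℓ hℓ ℓ' hℓ' v (by simpa using hv) (by simpa using hv'))
  rw [← h1, ← Finset.card_union_of_disjoint]
  · refine Finset.card_le_card (Finset.union_subset (Finset.filter_subset _ _) ?_)
    intro v hv
    obtain ⟨ℓ, hℓ, hv⟩ := Finset.mem_biUnion.1 hv
    exact hT ℓ hℓ v (by simpa using hv)
  · rw [Finset.disjoint_left]
    intro v hv hv'
    obtain ⟨ℓ, hℓ, hv'⟩ := Finset.mem_biUnion.1 hv'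
    exact (Finset.mem_filter.1 hv).2 ℓ hℓ (by simpa using hv')

/-- The arcs `𝒜` are the two orientations of the links of `I`, and the marked ones are orientations
of links in `M`. Links may be represented more than once. -/
structure Orients {A : Type*} (I : RootedAug V E) (M : Finset (Sym2 V)) (𝒜 : ArcFamily V A)
    (marked : A → Prop) : Prop where
  mem_links : ∀ a, s(𝒜.tail a, 𝒜.head a) ∈ I.links
  exists_arc : ∀ u v, s(u, v) ∈ I.links → ∃ a, 𝒜.tail a = u ∧ 𝒜.head a = v
  mem_of_marked : ∀ a, marked a → s(𝒜.tail a, 𝒜.head a) ∈ M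
  exists_marked : ∀ u v, s(u, v) ∈ M → ∃ a, marked a ∧ 𝒜.tail a = u ∧ 𝒜.head a = v

section Counting

variable [DecidableEq V] {A : Type*} {M : Finset (Sym2 V)} {𝒜 : ArcFamily V A} {marked : A → Prop}
  {st : A → ℕ} {q : ℕ} {D : ℕ → Finset V}

omit [Fintype V] [Fintype E] [DecidableEq V] in
theorem Orients.exists_leaves (hA : I.Orients M 𝒜 marked) {C : Finset V} {ℓ : Sym2 V}
    (hℓ : ℓ ∈ I.links) (hc : Crosses C ℓ) {t : V} (ht : t ∈ ℓ) (htC : t ∈ C) :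
    ∃ a, 𝒜.Leaves a C ∧ 𝒜.tail a = t := by
  obtain ⟨u, rfl⟩ := ht
  obtain ⟨a, rfl, rfl⟩ := hA.exists_arc _ _ hℓ
  rw [crosses_mk] at hc
  exact ⟨a, ⟨htC, by tauto⟩, rfl⟩

omit [DecidableEq V] in
theorem Orients.exists_leaves_of_isFeasible (hA : I.Orients M 𝒜 marked) (hf : I.IsFeasible)
    {C : Finset V} (hC : I.IsTwoCut C) : ∃ a, 𝒜.Leaves a C := by
  obtain ⟨ℓ, hℓ, hc⟩ := exists_cross_of_isFeasible hf hC
  obtain ⟨u, hu, v, hv, huC, hvC⟩ := id hc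
  obtain ⟨a, ha, -⟩ := hA.exists_leaves hℓ hc hu huC
  exact ⟨a, ha⟩

/-- The bound on the number of chosen sets. The starting vertices of the arcs that leave `D i` are
leaves; for different `i` they are disjoint, and a link of `M` meets them for at most one `i`. As no
link of `M` is bad, `D i` gets an unmatched leaf or at least two links of `M`, which are in-links
because `D i` is connected. -/
theorem two_mul_card_chosen_le (hG : I.graph.IsCactus) (hleaf : I.IsLeafToLeafPlus)
    (hf : I.IsFeasible) (hbad : ∀ ℓ ∈ M, ¬ I.IsBad ℓ) (hA : I.Orients M 𝒜 marked)
    (h : Stamped 𝒜 I.IsTwoCut marked st q D) :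
    2 * (Finset.Icc 2 q).card ≤ 2 * (I.graph.leaves.filter fun v => ∀ ℓ ∈ M, v ∉ ℓ).card +
      (I.inLinks M).card := by
  classical
  have hint := isIntersecting_isTwoCut hG
  let S : ℕ → Finset V := fun i =>
    Finset.univ.filter fun v => ∃ a, 𝒜.tail a = v ∧ 𝒜.Leaves a (D i)
  have hSD : ∀ i v, v ∈ S i → v ∈ D i := by
    intro i v hv
    obtain ⟨-, a, rfl, ha⟩ := Finset.mem_filter.1 hv
    exact ha.1
  have hSleaf : ∀ i, 2 ≤ i → i ≤ q → ∀ v ∈ S i, v ∈ I.graph.leaves := by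
    intro i hi hi' v hv
    obtain ⟨-, a, rfl, ha⟩ := Finset.mem_filter.1 hv
    rcases hleaf _ (hA.mem_links a) (𝒜.tail a) (by simp) with h' | h'
    · exact absurd (h' ▸ ha.1) (h.mem i hi hi').1
    · exact h'
  have hcov : ∀ i v, I.IsCoveringLeaf (D i) v → v ∈ S i := by
    rintro i v ⟨-, hvD, ℓ, hℓ, hv, hc⟩
    obtain ⟨a, ha, rfl⟩ := hA.exists_leaves hℓ hc hv hvD
    exact Finset.mem_filter.2 ⟨Finset.mem_univ _, a, rfl, ha⟩
  have hdisj : ∀ i j v, 2 ≤ i → i < j → j ≤ q → v ∈ S j → v ∉ D i := by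
    intro i j v hi hij hj hv
    obtain ⟨-, a, rfl, ha⟩ := Finset.mem_filter.1 hv
    exact h.tail_not_mem hint hi hij hj ha
  -- A link of `M` does not cross `D i`: its orientations have the stamp `1`.
  have hMD : ∀ i, 2 ≤ i → i ≤ q → ∀ ℓ ∈ M, ∀ u ∈ ℓ, ∀ v ∈ ℓ, u ∈ D i → v ∈ D i := by
    intro i hi hi' ℓ hℓ u hu v hv huD
    by_contra hvD
    have hne : v ≠ u := fun e => hvD (e ▸ huD)
    obtain rfl := (Sym2.mem_and_mem_iff hne).1 ⟨hv, hu⟩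
    rw [Sym2.eq_swap] at hℓ
    obtain ⟨a, ha, rfl, rfl⟩ := hA.exists_marked _ _ hℓ
    have h1 := (h.eq_one_iff a).2 ha
    have h2 := (h.eq_iff i hi hi' a).2 ⟨huD, hvD⟩
    omega
  refine two_mul_card_le_of_disjoint (J := Finset.Icc 2 q)
    (T := fun i => (S i).filter fun v => ∀ ℓ ∈ M, v ∉ ℓ)
    (S := fun i => (I.inLinks M).filter fun ℓ => ∃ v ∈ ℓ, v ∈ S i) ?_ ?_ ?_ ?_ ?_
  · intro i hi
    rw [Finset.mem_Icc] at hi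
    intro v hv
    rw [Finset.mem_filter] at hv ⊢
    exact ⟨hSleaf i hi.1 hi.2 v hv.1, hv.2⟩
  · exact fun i _ => Finset.filter_subset _ _
  · intro i hi j hj hij
    rw [Finset.mem_Icc] at hi hj
    rw [Finset.disjoint_left]
    intro v hv hv'
    exact hdisj i j v hi.1 hij hj.2 (Finset.mem_filter.1 hv').1 (hSD i v (Finset.mem_filter.1 hv).1)
  · intro i hi j hj hij
    rw [Finset.mem_Icc] at hi hj
    rw [Finset.disjoint_left]
    intro ℓ hℓ hℓ'
    obtain ⟨hm, u, hu, huS⟩ := Finset.mem_filter.1 hℓ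
    obtain ⟨-, v, hv, hvS⟩ := Finset.mem_filter.1 hℓ'
    exact hdisj i j v hi.1 hij hj.2 hvS
      (hMD i hi.1 hi.2 ℓ (Finset.mem_filter.1 hm).1 u hu v hv (hSD i u huS))
  · intro i hi
    rw [Finset.mem_Icc] at hi
    by_cases hU : ((S i).filter fun v => ∀ ℓ ∈ M, v ∉ ℓ).Nonempty
    · have := Finset.card_pos.2 hU
      omega
    -- Otherwise all of `S i` is matched, and non-badness yields a second link of `M` meeting it.
    · rw [Finset.not_nonempty_iff_eq_empty, Finset.filter_eq_empty_iff] at hU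
      have hmatch : ∀ v ∈ S i, ∃ ℓ ∈ M, v ∈ ℓ := by
        intro v hv
        have := hU hv
        push Not at this
        exact this
      have hmem : ∀ v ∈ S i, ∀ ℓ ∈ M, v ∈ ℓ →
          ℓ ∈ (I.inLinks M).filter fun ℓ => ∃ v ∈ ℓ, v ∈ S i := by
        intro v hv ℓ hℓ hvℓ
        refine Finset.mem_filter.2 ⟨Finset.mem_filter.2 ⟨hℓ, ?_⟩, v, hvℓ, hv⟩
        obtain ⟨w, rfl⟩ := id hvℓ
        exact (h.mem i hi.1 hi.2).isInLink hG (hSD i v hv)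
          (hMD i hi.1 hi.2 _ hℓ v hvℓ w (by simp) (hSD i v hv))
      obtain ⟨a, ha⟩ := hA.exists_leaves_of_isFeasible hf (h.mem i hi.1 hi.2)
      have haS : 𝒜.tail a ∈ S i := Finset.mem_filter.2 ⟨Finset.mem_univ _, a, rfl, ha⟩
      obtain ⟨ℓ, hℓ, haℓ⟩ := hmatch _ haS
      obtain ⟨t, ht, htℓ⟩ : ∃ t, I.IsCoveringLeaf (D i) t ∧ t ∉ ℓ := by
        by_contra! hcon
        exact hbad ℓ hℓ ⟨D i, h.mem i hi.1 hi.2, hcon, fun v hv =>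
          hMD i hi.1 hi.2 ℓ hℓ _ haℓ v hv ha.1⟩
      obtain ⟨ℓ', hℓ', htℓ'⟩ := hmatch t (hcov i t ht)
      have hne : ℓ ≠ ℓ' := fun e => htℓ (e ▸ htℓ')
      have : 1 < ((I.inLinks M).filter fun ℓ => ∃ v ∈ ℓ, v ∈ S i).card :=
        Finset.one_lt_card.2 ⟨ℓ, hmem _ haS ℓ hℓ haℓ, ℓ', hmem t (hcov i t ht) ℓ' hℓ' htℓ', hne⟩
      omega

/-- The links that remain in use after pruning form the required solution. -/
theorem isSolution_and_card_le [Fintype A] (hI : I.IsCacAP) (hleaf : I.IsLeafToLeafPlus)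
    (hf : I.IsFeasible) (hM : I.IsLeafMatching M) (hbad : ∀ ℓ ∈ M, ¬ I.IsBad ℓ)
    (hA : I.Orients M 𝒜 marked) {st₀ : A → ℕ} (h : Stamped 𝒜 I.IsTwoCut marked st₀ q D)
    (hsub : ∀ a, st a = 0 ∨ st a = st₀ a) (hone : ∀ a, marked a → st a ≠ 0)
    (hcov : ∀ X, I.IsTwoCut X → ∃ a, st a ≠ 0 ∧ 𝒜.Leaves a X)
    (hset : ∀ a, 2 ≤ st₀ a → Settled 𝒜 I.IsTwoCut st₀ st a) {F : Finset (Sym2 V)}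
    (hF : ∀ ℓ, ℓ ∈ F ↔ ∃ a, st a ≠ 0 ∧ s(𝒜.tail a, 𝒜.head a) = ℓ) :
    I.IsSolution F ∧ M ⊆ F ∧ (F.card : ℚ) ≤ (M.card : ℚ) + 1 / 2 * ((I.inLinks M).card : ℚ)
      + ((I.graph.leaves.card : ℚ) - 2 * (M.card : ℚ)) := by
  refine ⟨isSolution_of_cross hI.1 ?_ ?_, ?_, ?_⟩
  · intro ℓ hℓ
    obtain ⟨a, -, rfl⟩ := (hF ℓ).1 hℓ
    exact hA.mem_links a
  · intro C hC
    obtain ⟨a, ha, hl⟩ := hcov C hC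
    exact ⟨_, (hF _).2 ⟨a, ha, rfl⟩, crosses_mk.2 (.inl hl)⟩
  · intro ℓ
    induction ℓ using Sym2.ind with
    | _ u v =>
      intro hℓ
      obtain ⟨a, ha, rfl, rfl⟩ := hA.exists_marked u v hℓ
      exact (hF _).2 ⟨a, hone a ha, rfl⟩
  · have h1 : F.card ≤ M.card + (Finset.Icc 2 q).card := by
      refine le_trans ?_ (Nat.add_le_add_left
        (card_pruned_le h (isIntersecting_isTwoCut hI.1) hsub hcov hset) _)
      refine le_trans ?_ (Nat.add_le_add_left
        (Finset.card_image_le (f := fun a => s(𝒜.tail a, 𝒜.head a))) _)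
      refine (Finset.card_le_card fun ℓ hℓ => ?_).trans (Finset.card_union_le _ _)
      obtain ⟨a, ha, rfl⟩ := (hF ℓ).1 hℓ
      rw [Finset.mem_union]
      by_cases h2 : 2 ≤ st a
      · exact .inr (Finset.mem_image_of_mem _ (by simpa using h2))
      · refine .inl (hA.mem_of_marked a ((h.eq_one_iff a).1 ?_))
        rcases hsub a with h | h <;> omega
    have h2 := two_mul_card_chosen_le hI.1 hleaf hf hbad hA h
    have h3 := card_unmatched_add_le (T := I.graph.leaves) (M := M)
      (fun ℓ hℓ => hI.2 ℓ (hM.1 hℓ)) hM.2.1 hM.2.2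
    have h4 : 2 * F.card + 2 * M.card ≤ (I.inLinks M).card + 2 * I.graph.leaves.card := by omega
    have h5 : (2 * F.card + 2 * M.card : ℚ) ≤ (I.inLinks M).card + 2 * I.graph.leaves.card := by
      exact_mod_cast h4
    linarith

end Counting

end RootedAug

/-! ### The program -/

/-!
Variables: `4` is the number of arcs, `5` the current stamp, `6` the current size, `7` and `8` hold
a pair of edges, `9` and `10` are inner counters, `11` is the size of a side, `12` the number of
stamped arcs leaving it, `13` the arc under examination, and `14` counts uncovered sides. Arrays:
`6` is the indicator function of the vertices reachable from the root, `7` and `8` hold the tails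
and heads of the arcs, and `9` holds their stamps.
-/

namespace RAM

open RAM.Expr RAM.Prog

/-- The distance of two numbers; it is nonzero if and only if they differ. -/
def Expr.dist (e f : Expr) : Expr := add (sub e f) (sub f e)

/-- Set up the two orientations of each link; the marked ones get the stamp `1`. -/
def initArcs : Prog :=
  seq (assign 4 (add (.var 2) (.var 2))) <|
  seq (forLoop 9 (.var 2) <|
    seq (store 7 (.var 9) (get 2 (.var 9))) <|
    seq (store 8 (.var 9) (get 3 (.var 9))) <|
    seq (store 9 (.var 9) (get 4 (.var 9))) <|
    seq (store 7 (add (.var 2) (.var 9)) (get 3 (.var 9))) <|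
    seq (store 8 (add (.var 2) (.var 9)) (get 2 (.var 9))) <|
    store 9 (add (.var 2) (.var 9)) (get 4 (.var 9))) <|
  assign 5 (const 1)

/-- Propagate reachability along the edge in variable `10`, unless it is one of the two edges that
are taken out. -/
def relax : Prog :=
  guarded (dist (.var 10) (.var 7)) <| guarded (dist (.var 10) (.var 8)) <|
  guarded (add (get 6 (get 0 (.var 10))) (get 6 (get 1 (.var 10)))) <|
  seq (store 6 (get 0 (.var 10)) (const 1)) (store 6 (get 1 (.var 10)) (const 1))

/-- Compute the vertices reachable from the root when two edges are taken out. -/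
def reach : Prog :=
  seq (forLoop 9 (.var 0) (store 6 (.var 9) (const 0))) <|
  seq (store 6 (.var 3) (const 1)) <|
  forLoop 9 (.var 0) (forLoop 10 (.var 1) relax)

/-- Compute the side of a pair of edges, its size, and the number of stamped arcs leaving it. -/
def scan : Prog :=
  seq reach <|
  seq (assign 11 (const 0)) <|
  seq (forLoop 9 (.var 0) (assign 11 (add (.var 11) (sub (const 1) (get 6 (.var 9)))))) <|
  seq (assign 12 (const 0)) <|
  forLoop 9 (.var 4) (assign 12 (add (.var 12)
    (sub (sub (get 6 (get 8 (.var 9))) (get 6 (get 7 (.var 9)))) (sub (const 1) (get 9 (.var 9))))))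

/-- Execute `c` for all pairs of edges. -/
def forPairs (c : Prog) : Prog := forLoop 7 (.var 1) (forLoop 8 (.var 1) c)

/-- Give the current stamp to all arcs that leave the current side. -/
def stampLeaving : Prog :=
  forLoop 9 (.var 4) <|
  guarded (sub (get 6 (get 8 (.var 9))) (get 6 (get 7 (.var 9)))) (store 9 (.var 9) (.var 5))

/-- Choose the current side if it has the right size and no stamped arc leaves it. -/
def choose : Prog :=
  seq scan <|
  guarded (sub (const 1) (add (dist (.var 11) (add (.var 6) (const 1))) (.var 12))) <|
  seq (assign 5 (add (.var 5) (const 1))) stampLeaving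

/-- The dual phase: choose sets in the order of their sizes. -/
def dualPhase : Prog := forLoop 6 (.var 0) (forPairs choose)

/-- Count the sides of pairs of edges that no stamped arc leaves. -/
def countUncovered : Prog :=
  forPairs (seq scan (guarded (.var 11) (assign 14 (add (.var 14) (sub (const 1) (.var 12))))))

/-- Remove the arc in variable `13` if it has the current stamp and is not needed. -/
def pruneArc : Prog :=
  guarded (sub (const 1) (dist (get 9 (.var 13)) (.var 5))) <|
  seq (store 9 (.var 13) (const 0)) <|
  seq (assign 14 (const 0)) <|
  seq countUncovered <|
  guarded (.var 14) (store 9 (.var 13) (.var 5))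

/-- The pruning phase: examine the arcs in the order of decreasing stamps. -/
def prunePhase : Prog :=
  loop (sub (.var 5) (const 1)) <|
  seq (forLoop 13 (.var 4) pruneArc) (assign 5 (sub (.var 5) (const 1)))

/-- Select the links of which an orientation is still in use. -/
def writeOutput : Prog :=
  forLoop 9 (.var 2) (store 5 (.var 9) (add (get 9 (.var 9)) (get 9 (add (.var 2) (.var 9)))))

/-- The complete algorithm. -/
def augment : Prog := seq initArcs (seq dualPhase (seq prunePhase writeOutput))

end RAM

/-! ### Correctness of the program -/

namespace AugInput

open RAM Multigraph

variable {I : AugInput} {N : ℕ} {s : Memory}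

/-- The two orientations of each listed link. -/
def arcs (I : AugInput) : ArcFamily (Fin I.n) (Fin (I.k + I.k)) where
  tail := Fin.append (fun i => (I.link i).1) fun i => (I.link i).2
  head := Fin.append (fun i => (I.link i).2) fun i => (I.link i).1

/-- The marks of the arcs. -/
def markedArc (I : AugInput) (a : Fin (I.k + I.k)) : Prop :=
  Fin.append I.marked I.marked a = true

section ArcLemmas

variable (i : Fin I.k)

theorem tail_castAdd : I.arcs.tail (Fin.castAdd I.k i) = (I.link i).1 := by
  simp only [arcs, Fin.append_left]

theorem head_castAdd : I.arcs.head (Fin.castAdd I.k i) = (I.link i).2 := by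
  simp only [arcs, Fin.append_left]

theorem tail_natAdd : I.arcs.tail (Fin.natAdd I.k i) = (I.link i).2 := by
  simp only [arcs, Fin.append_right]

theorem head_natAdd : I.arcs.head (Fin.natAdd I.k i) = (I.link i).1 := by
  simp only [arcs, Fin.append_right]

theorem markedArc_castAdd : I.markedArc (Fin.castAdd I.k i) ↔ I.marked i = true := by
  rw [markedArc, Fin.append_left]

theorem markedArc_natAdd : I.markedArc (Fin.natAdd I.k i) ↔ I.marked i = true := by
  rw [markedArc, Fin.append_right]

theorem link_castAdd :
    s(I.arcs.tail (Fin.castAdd I.k i), I.arcs.head (Fin.castAdd I.k i)) = I.linkAt i := by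
  rw [tail_castAdd, head_castAdd, linkAt]

theorem link_natAdd :
    s(I.arcs.tail (Fin.natAdd I.k i), I.arcs.head (Fin.natAdd I.k i)) = I.linkAt i := by
  rw [tail_natAdd, head_natAdd, linkAt, Sym2.eq_swap]

end ArcLemmas

theorem orients (I : AugInput) : I.inst.Orients I.matching I.arcs I.markedArc where
  mem_links a := by
    induction a using Fin.addCases with
    | left i => rw [link_castAdd]; exact Finset.mem_image_of_mem _ (Finset.mem_univ i)
    | right i => rw [link_natAdd]; exact Finset.mem_image_of_mem _ (Finset.mem_univ i)
  exists_arc u v h := by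
    simp only [inst, Finset.mem_image, Finset.mem_univ, true_and, linkAt, Sym2.eq_iff] at h
    obtain ⟨i, ⟨h1, h2⟩ | ⟨h1, h2⟩⟩ := h
    · exact ⟨_, (tail_castAdd i).trans h1, (head_castAdd i).trans h2⟩
    · exact ⟨_, (tail_natAdd i).trans h2, (head_natAdd i).trans h1⟩
  mem_of_marked a h := by
    simp only [matching, Finset.mem_image, Finset.mem_filter, Finset.mem_univ, true_and]
    induction a using Fin.addCases with
    | left i => exact ⟨i, (markedArc_castAdd i).1 h, (link_castAdd i).symm⟩
    | right i => exact ⟨i, (markedArc_natAdd i).1 h, (link_natAdd i).symm⟩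
  exists_marked u v h := by
    simp only [matching, Finset.mem_image, Finset.mem_filter, Finset.mem_univ, true_and, linkAt,
      Sym2.eq_iff] at h
    obtain ⟨i, hi, ⟨h1, h2⟩ | ⟨h1, h2⟩⟩ := h
    · exact ⟨_, (markedArc_castAdd i).2 hi, (tail_castAdd i).trans h1, (head_castAdd i).trans h2⟩
    · exact ⟨_, (markedArc_natAdd i).2 hi, (tail_natAdd i).trans h2, (head_natAdd i).trans h1⟩

/-- The memory holds the graph and the arcs. -/
structure Holds (I : AugInput) (s : Memory) : Prop where
  n : s.var 0 = I.n
  m : s.var 1 = I.m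
  k : s.var 2 = I.k
  root : s.var 3 = I.root
  arcs : s.var 4 = I.k + I.k
  fst : ∀ g : Fin I.m, s.arr 0 g = (I.edge g).1
  snd : ∀ g : Fin I.m, s.arr 1 g = (I.edge g).2
  tail : ∀ a : Fin (I.k + I.k), s.arr 7 a = I.arcs.tail a
  head : ∀ a : Fin (I.k + I.k), s.arr 8 a = I.arcs.head a

theorem Holds.frame {vs as : List ℕ} {s' : Memory} (h : Holds I s) (hf : Frame vs as s s')
    (hv : ∀ x < 5, x ∉ vs) (ha : 0 ∉ as ∧ 1 ∉ as ∧ 7 ∉ as ∧ 8 ∉ as) : Holds I s' where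
  n := (hf.1 0 (hv 0 (by omega))).trans h.n
  m := (hf.1 1 (hv 1 (by omega))).trans h.m
  k := (hf.1 2 (hv 2 (by omega))).trans h.k
  root := (hf.1 3 (hv 3 (by omega))).trans h.root
  arcs := (hf.1 4 (hv 4 (by omega))).trans h.arcs
  fst g := by rw [hf.2 0 ha.1]; exact h.fst g
  snd g := by rw [hf.2 1 ha.2.1]; exact h.snd g
  tail a := by rw [hf.2 7 ha.2.2.1]; exact h.tail a
  head a := by rw [hf.2 8 ha.2.2.2]; exact h.head a

/-- The memory holds the stamps `st`. -/
def HoldsStamps (I : AugInput) (s : Memory) (st : Fin (I.k + I.k) → ℕ) : Prop :=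
  ∀ a : Fin (I.k + I.k), s.arr 9 a = st a

/-- The memory holds the indicator function of `S`. -/
def HoldsSet (I : AugInput) (s : Memory) (S : Finset (Fin I.n)) : Prop :=
  ∀ v : Fin I.n, s.arr 6 v = if v ∈ S then 1 else 0

instance (a : Fin (I.k + I.k)) : Decidable (I.markedArc a) := by
  unfold markedArc; infer_instance

theorem runs_initArcs (hk : I.k ≤ N) : Runs N initArcs I.memory fun s => Holds I s ∧
    s.var 5 = 1 ∧ HoldsStamps I s fun a => if I.markedArc a then 1 else 0 := by
  refine .seq (.assign (.seq (.mono (.for_loop (M := I.k) (fun i s =>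
    ∀ j < i, ∀ hj : j < I.k, s.arr 7 j = (I.link ⟨j, hj⟩).1 ∧ s.arr 8 j = (I.link ⟨j, hj⟩).2 ∧
      s.arr 9 j = (if I.marked ⟨j, hj⟩ then 1 else 0) ∧ s.arr 7 (I.k + j) = (I.link ⟨j, hj⟩).2 ∧
      s.arr 8 (I.k + j) = (I.link ⟨j, hj⟩).1 ∧
      s.arr 9 (I.k + j) = (if I.marked ⟨j, hj⟩ then 1 else 0)) hk (by decide) ?_ ?_ ?_) ?_)))
  · intro s' hf
    have := hf.1 2 (by decide)
    simpa [Expr.eval, memory] using this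
  · intro j hj; omega
  · intro i hi s' hf hx hinv
    have h2 : s'.var 2 = I.k := by simpa [memory] using hf.1 2 (by decide)
    have a2 : s'.arr 2 i = (I.link ⟨i, hi⟩).1 := by
      rw [hf.2 2 (by decide)]; simp [memory, hi]
    have a3 : s'.arr 3 i = (I.link ⟨i, hi⟩).2 := by
      rw [hf.2 3 (by decide)]; simp [memory, hi]
    have a4 : s'.arr 4 i = if I.marked ⟨i, hi⟩ then 1 else 0 := by
      rw [hf.2 4 (by decide)]; simp [memory, hi]
    refine .seq (.store (.seq (.store (.seq (.store (.seq (.store (.seq (.store (.store ?_))))))))))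
    intro j hj hjk
    rcases Nat.lt_succ_iff_lt_or_eq.1 hj with hlt | rfl
    · have e1 : j ≠ i := by omega
      have e2 : j ≠ I.k + i := by omega
      have e3 : I.k + j ≠ i := by omega
      simpa [Expr.eval, hx, h2, a2, a3, a4, e1, e2, e3] using hinv j hlt hjk
    · have e2 : I.k ≠ 0 := by omega
      simp [Expr.eval, hx, h2, a2, a3, a4, e2]
  · intro s' hf h
    refine .assign ⟨⟨?_, ?_, ?_, ?_, ?_, ?_, ?_, ?_, ?_⟩, by simp [Expr.eval], ?_⟩
    · simpa [memory] using hf.1 0 (by decide)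
    · simpa [memory] using hf.1 1 (by decide)
    · simpa [memory] using hf.1 2 (by decide)
    · simpa [memory] using hf.1 3 (by decide)
    · simpa [memory, Expr.eval] using hf.1 4 (by decide)
    · intro g
      simp [hf.2 0 (by decide), memory]
    · intro g
      simp [hf.2 1 (by decide), memory]
    · intro a
      induction a using Fin.addCases with
      | left i => rw [tail_castAdd]; exact (h i i.2 i.2).1
      | right i => rw [tail_natAdd]; exact (h i i.2 i.2).2.2.2.1
    · intro a
      induction a using Fin.addCases with
      | left i => rw [head_castAdd]; exact (h i i.2 i.2).2.1
      | right i => rw [head_natAdd]; exact (h i i.2 i.2).2.2.2.2.1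
    · intro a
      induction a using Fin.addCases with
      | left i => simp only [markedArc_castAdd]; exact (h i i.2 i.2).2.2.1
      | right i => simp only [markedArc_natAdd]; exact (h i i.2 i.2).2.2.2.2.2

/-- The side of a pair of edges of the instance. -/
noncomputable abbrev side (I : AugInput) (e f : Fin I.m) : Finset (Fin I.n) := I.inst.side e f

theorem eval_dist {x y : Expr} : (x.dist y).eval s = 0 ↔ x.eval s = y.eval s := by
  simp only [Expr.dist, Expr.eval]
  omega

theorem runs_relax (hs : Holds I s) {e f g : Fin I.m} (he : s.var 7 = e) (hf : s.var 8 = f)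
    (hg : s.var 10 = g) {S : Finset (Fin I.n)} (hS : HoldsSet I s S) :
    Runs N relax s fun s' => HoldsSet I s' (if g ≠ e ∧ g ≠ f ∧ ((I.edge g).1 ∈ S ∨ (I.edge g).2 ∈ S)
      then insert (I.edge g).1 (insert (I.edge g).2 S) else S) := by
  have h1 := hs.fst g
  have h2 := hs.snd g
  have h3 : (Expr.add (.get 6 (.get 0 (.var 10))) (.get 6 (.get 1 (.var 10)))).eval s ≠ 0 ↔
      (I.edge g).1 ∈ S ∨ (I.edge g).2 ∈ S := by
    simp only [Expr.eval, hg, h1, h2]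
    rw [hS, hS]
    split_ifs <;> simp_all
  refine .guarded (fun c1 => .guarded (fun c2 => .guarded (fun c3 => ?_) fun c3 => ?_) fun c2 => ?_)
    fun c1 => ?_
  · rw [Ne, eval_dist, Expr.eval, Expr.eval, he, hg, ← Fin.ext_iff] at c1
    rw [Ne, eval_dist, Expr.eval, Expr.eval, hf, hg, ← Fin.ext_iff] at c2
    rw [if_pos ⟨c1, c2, h3.1 c3⟩]
    refine .seq (.store (.store fun v => ?_))
    have := hS v
    simp only [Expr.eval, hg, h1, h2, Memory.setArr_arr, Memory.setArr_var, true_and,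
      Finset.mem_insert, Fin.ext_iff, this]
    split_ifs <;> simp_all
  · rw [if_neg fun h => h3.2 h.2.2 c3]
    exact hS
  · rw [eval_dist, Expr.eval, Expr.eval, hf, hg, ← Fin.ext_iff] at c2
    rw [if_neg fun h => h.2.1 c2]
    exact hS
  · rw [eval_dist, Expr.eval, Expr.eval, he, hg, ← Fin.ext_iff] at c1
    rw [if_neg fun h => h.1 c1]
    exact hS

/-- No edge except `e` and `f` has exactly one end in `S`. -/
def ClosedOff (I : AugInput) (e f : Fin I.m) (S : Finset (Fin I.n)) : Prop :=
  ∀ g, g ≠ e → g ≠ f → ((I.edge g).1 ∈ S ↔ (I.edge g).2 ∈ S)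

theorem mem_side_iff_of_edge {e f g : Fin I.m} (he : g ≠ e) (hf : g ≠ f) :
    (I.edge g).1 ∈ I.side e f ↔ (I.edge g).2 ∈ I.side e f :=
  RootedAug.mem_side_iff_of_ends rfl he hf

theorem compl_eq_side {e f : Fin I.m} {S : Finset (Fin I.n)} (hr : I.root ∈ S)
    (hd : Disjoint S (I.side e f)) (hc : ClosedOff I e f S) : Sᶜ = I.side e f := by
  ext v
  rw [Finset.mem_compl]
  refine ⟨fun hv => RootedAug.mem_side.2 ⟨Sᶜ, Finset.mem_compl.2 hv, ?_, fun g hg => ?_⟩,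
    fun hv hvS => Finset.disjoint_left.1 hd hvS hv⟩
  · rw [Finset.mem_compl, not_not]; exact hr
  · by_contra hn
    simp only [Finset.mem_insert, Finset.mem_singleton, not_or] at hn
    have h := hc g hn.1 hn.2
    rw [mem_cut, inst, crosses_mk] at hg
    simp only [Finset.mem_compl] at hg
    tauto

/-- One pass over all edges: the result contains the ends of all edges that had an end in `S`. -/
theorem runs_relax_pass (hN : I.m ≤ N) (hs : Holds I s) {e f : Fin I.m} (he : s.var 7 = e)
    (hf : s.var 8 = f) {S : Finset (Fin I.n)} (hS : HoldsSet I s S)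
    (hd : Disjoint S (I.side e f)) :
    Runs N (forLoop 10 (.var 1) relax) s fun s' => ∃ S', HoldsSet I s' S' ∧ S ⊆ S' ∧
      Disjoint S' (I.side e f) ∧ (ClosedOff I e f S → S' = S) ∧
      (S' = S → ClosedOff I e f S) := by
  refine .mono (.for_loop (M := I.m) (fun i s' => ∃ S', HoldsSet I s' S' ∧ S ⊆ S' ∧
    Disjoint S' (I.side e f) ∧ (ClosedOff I e f S → S' = S) ∧
    ∀ g : Fin I.m, (g : ℕ) < i → g ≠ e → g ≠ f → (I.edge g).1 ∈ S ∨ (I.edge g).2 ∈ S →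
      (I.edge g).1 ∈ S' ∧ (I.edge g).2 ∈ S') hN (by decide) ?_ ?_ ?_) ?_
  · intro s' hfr
    exact (hfr.1 1 (by decide)).trans hs.m
  · exact ⟨S, hS, subset_rfl, hd, fun _ => rfl, fun g hg => by omega⟩
  · rintro i hi s' hfr hx ⟨S', hS', hsub, hd', hcl, hdone⟩
    have hs' := hs.frame hfr (by decide) (by decide)
    refine .mono (runs_relax (g := ⟨i, hi⟩) hs' ((hfr.1 7 (by decide)).trans he)
      ((hfr.1 8 (by decide)).trans hf) hx hS') fun s'' _ h => ⟨_, h, ?_⟩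
    split_ifs with hc
    · obtain ⟨h1, h2, h3⟩ := hc
      have hside := mem_side_iff_of_edge (I := I) h1 h2
      refine ⟨fun v hv => by simp [hsub hv], ?_, fun h => ?_, fun g hg g1 g2 g3 => ?_⟩
      · rw [Finset.disjoint_insert_left, Finset.disjoint_insert_left]
        have : (I.edge ⟨i, hi⟩).1 ∉ I.side e f ∨ (I.edge ⟨i, hi⟩).2 ∉ I.side e f :=
          h3.imp (Finset.disjoint_left.1 hd' ·) (Finset.disjoint_left.1 hd' ·)
        tauto
      · obtain rfl := hcl h
        have := h _ h1 h2
        rw [Finset.insert_eq_of_mem, Finset.insert_eq_of_mem]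
        · tauto
        · rw [Finset.mem_insert]; tauto
      · rcases Nat.lt_succ_iff_lt_or_eq.1 hg with hlt | heq
        · have := hdone g hlt g1 g2 g3
          simp [this]
        · obtain rfl : g = ⟨i, hi⟩ := Fin.ext heq
          simp
    · refine ⟨hsub, hd', hcl, fun g hg g1 g2 g3 => ?_⟩
      rcases Nat.lt_succ_iff_lt_or_eq.1 hg with hlt | heq
      · exact hdone g hlt g1 g2 g3
      · obtain rfl : g = ⟨i, hi⟩ := Fin.ext heq
        exact absurd ⟨g1, g2, g3.imp (@hsub _) (@hsub _)⟩ hc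
  · rintro s' - ⟨S', h1, h2, h3, h4, h5⟩
    refine ⟨S', h1, h2, h3, h4, ?_⟩
    rintro rfl g hge hgf
    have := h5 g g.2 hge hgf
    tauto

/-- After `i` passes the set of vertices found is closed or has more than `i` elements. -/
theorem runs_reach (hn : I.n ≤ N) (hm : I.m ≤ N) (hs : Holds I s) {e f : Fin I.m}
    (he : s.var 7 = e) (hf : s.var 8 = f) :
    Runs N reach s fun s' => HoldsSet I s' (I.side e f)ᶜ := by
  refine .seq (.mono (.for_loop (M := I.n) (fun i s' => ∀ j < i, s'.arr 6 j = 0) hn (by decide)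
    ?_ (fun j hj => by omega) ?_) fun s₁ hf₁ h₁ => .seq (.store ?_))
  · intro s' hfr
    exact (hfr.1 0 (by decide)).trans hs.n
  · intro i hi s' _ hx hinv
    refine .store fun j hj => ?_
    have := hinv j
    simp only [Expr.eval, hx, Memory.setVar_arr, Memory.setArr_arr, true_and]
    split_ifs
    · rfl
    · exact this (by omega)
  · set s₂ := s₁.setArr 6 (Expr.eval s₁ (.var 3)) (Expr.eval s₁ (.const 1)) with hs₂
    have hf₁' : Frame [9] [6] s s₁ := hf₁.mono (by decide) (by decide)
    have hfr₂ : Frame [9] [6] s s₂ := by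
      refine ⟨fun x hx => hf₁'.1 x hx, fun a ha => ?_⟩
      funext j
      have ha6 : a ≠ 6 := by simpa using ha
      simp [hs₂, ha6, hf₁'.2 a ha]
    have hs2 := hs.frame hfr₂ (by decide) (by decide)
    have hroot : s₁.var 3 = I.root := (hf₁.1 3 (by decide)).trans hs.root
    refine .mono (.for_loop (M := I.n) (fun i s' => ∃ S, HoldsSet I s' S ∧ I.root ∈ S ∧
      Disjoint S (I.side e f) ∧ (ClosedOff I e f S ∨ i + 1 ≤ S.card)) hn (by decide) ?_ ?_ ?_) ?_
    · intro s' hfr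
      exact (hfr.1 0 (by decide)).trans hs2.n
    · refine ⟨{I.root}, fun v => ?_, by simp, ?_, .inr (by simp)⟩
      · have := h₁ v v.2
        simp [hs₂, Expr.eval, hroot, this, Fin.ext_iff]
      · rw [Finset.disjoint_singleton_left]
        exact RootedAug.root_not_mem_side
    · rintro i hi s' hfr hx ⟨S, hS, hr, hd, hc⟩
      have hs' := hs2.frame hfr (by decide) (by decide)
      refine .mono (runs_relax_pass hm hs'
        ((hfr.1 7 (by decide)).trans ((hfr₂.1 7 (by decide)).trans he))
        ((hfr.1 8 (by decide)).trans ((hfr₂.1 8 (by decide)).trans hf)) hS hd) ?_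
      rintro s'' - ⟨S', hS', hsub, hd', h1, h2⟩
      refine ⟨S', hS', hsub hr, hd', ?_⟩
      by_cases hcl : ClosedOff I e f S
      · exact .inl ((h1 hcl).symm ▸ hcl)
      · have hlt : S.card < S'.card :=
          Finset.card_lt_card (hsub.ssubset_of_ne fun h => hcl (h2 h.symm))
        have := hc.resolve_left hcl
        exact .inr (by omega)
    · rintro s' - ⟨S, hS, hr, hd, hc⟩
      -- After `n` passes the second alternative would exceed the number of vertices.
      have hcl : ClosedOff I e f S := by
        refine hc.resolve_right fun h => ?_
        have := S.card_le_univ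
        rw [Fintype.card_fin] at this
        omega
      rw [← compl_eq_side hr hd hcl, compl_compl]
      exact hS

/-- Some arc with a nonzero stamp leaves `C`. -/
def Covered (I : AugInput) (st : Fin (I.k + I.k) → ℕ) (C : Finset (Fin I.n)) : Prop :=
  ∃ a, st a ≠ 0 ∧ I.arcs.Leaves a C

/-- The test for leaving a side that the program uses, with truncated subtraction. -/
theorem eval_leaves (hs : Holds I s) {e f : Fin I.m} (hS : HoldsSet I s (I.side e f)ᶜ)
    (a : Fin (I.k + I.k)) :
    s.arr 6 (s.arr 8 a) - s.arr 6 (s.arr 7 a) = if I.arcs.Leaves a (I.side e f) then 1 else 0 := by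
  rw [hs.head a, hs.tail a, hS, hS]
  simp only [Finset.mem_compl, ArcFamily.Leaves]
  split_ifs <;> simp_all

theorem runs_scan (hn : I.n ≤ N) (hm : I.m ≤ N) (hk : I.k + I.k ≤ N) (hs : Holds I s)
    {e f : Fin I.m} (he : s.var 7 = e) (hf : s.var 8 = f) {st : Fin (I.k + I.k) → ℕ}
    (hst : HoldsStamps I s st) :
    Runs N scan s fun s' => HoldsSet I s' (I.side e f)ᶜ ∧ s'.var 11 = (I.side e f).card ∧
      (s'.var 12 = 0 ↔ ¬ I.Covered st (I.side e f)) := by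
  refine .seq (.mono (runs_reach hn hm hs he hf) fun s₁ hf₁ h₁ => .seq (.assign ?_))
  have hs₁ := hs.frame hf₁ (by decide) (by decide)
  refine .seq (.mono (.for_sum (M := I.n) (fun i => 1 - s₁.arr 6 i) hn (by decide)
    (fun s' h => ?_) ?_) fun s₂ hf₂ h₂ => .seq (.assign ?_))
  · simpa [Expr.eval] using (h.1 0 (by decide)).trans (by simpa using hs₁.n)
  · intro i hi s' h hx
    simp [Expr.eval, hx, h.2 6 (by decide)]
  have hf₂' : Frame [9, 11, 12] [] s₁ (s₂.setVar 12 (Expr.eval s₂ (.const 0))) :=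
    .setVar (.trans (.setVar (Frame.refl _ _ _) (by decide)) (hf₂.mono (by decide) (by decide)))
      (by decide)
  have hs₂ := hs₁.frame hf₂' (by decide) (by decide)
  refine .mono (.for_sum (M := I.k + I.k)
    (fun i => s₁.arr 6 (s₁.arr 8 i) - s₁.arr 6 (s₁.arr 7 i) - (1 - s₁.arr 9 i)) hk (by decide)
    (fun s' h => ?_) ?_) fun s₃ hf₃ h₃ => ⟨?_, ?_, ?_⟩
  · exact (h.1 4 (by decide)).trans hs₂.arcs
  · intro i hi s' h hx
    have hf₃ := hf₂'.trans (h.mono (by decide) (by decide))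
    simp [Expr.eval, hx, hf₃.2 6 (by decide), hf₃.2 7 (by decide), hf₃.2 8 (by decide),
      hf₃.2 9 (by decide)]
  · intro v
    rw [hf₃.2 6 (by decide), hf₂'.2 6 (by decide)]
    exact h₁ v
  · rw [hf₃.1 11 (by decide), Memory.setVar_var, if_neg (by decide), h₂, Memory.setVar_var,
      if_pos rfl, Expr.eval, Nat.zero_add, Finset.sum_range]
    have : ∀ v : Fin I.n, 1 - s₁.arr 6 v = if v ∈ I.side e f then 1 else 0 := by
      intro v
      simp only [h₁ v, Finset.mem_compl]
      split_ifs <;> simp_all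
    simp only [this, Finset.sum_boole]
    simp
  · rw [h₃, Memory.setVar_var, if_pos rfl, Expr.eval, Nat.zero_add, Finset.sum_range,
      Finset.sum_eq_zero_iff]
    simp only [Finset.mem_univ, true_imp_iff, Covered, not_exists]
    refine forall_congr' fun a => ?_
    have hst₁ : s₁.arr 9 a = st a := by rw [hf₁.2 9 (by decide)]; exact hst a
    rw [eval_leaves hs₁ h₁, hst₁]
    by_cases hl : I.arcs.Leaves a (I.side e f)
    · rw [if_pos hl]
      simp only [hl, and_true]
      omega
    · simp [hl]

/-- Invariant rule for the loop over all pairs of edges. -/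
theorem runs_forPairs {c : Prog} (Inv : Set (Fin I.m × Fin I.m) → Memory → Prop) (hm : I.m ≤ N)
    (hc : 1 ∉ c.vars ∧ 7 ∉ c.vars ∧ 8 ∉ c.vars) (hs : s.var 1 = I.m)
    (hset : ∀ P s' y, Inv P s' → Inv P (s'.setVar 7 y) ∧ Inv P (s'.setVar 8 y)) (h0 : Inv ∅ s)
    (step : ∀ P (e f : Fin I.m) (s' : Memory), s'.var 7 = e → s'.var 8 = f → Inv P s' →
      Runs N c s' (Inv (insert (e, f) P))) :
    Runs N (forPairs c) s (Inv Set.univ) := by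
  have hv : ∀ x, x ∈ (forLoop 8 (.var 1) c).vars → x = 8 ∨ x ∈ c.vars := by
    simp [forLoop, Prog.vars]; tauto
  refine .mono (.for_loop (M := I.m) (fun i => Inv {p | (p.1 : ℕ) < i}) hm ?_ ?_ ?_ ?_) ?_
  · intro h
    rcases hv 7 h with h | h
    · omega
    · exact hc.2.1 h
  · intro s' hf
    refine (hf.1 1 fun h => ?_).trans hs
    rcases List.mem_cons.1 h with h | h
    · omega
    · rcases hv 1 h with h | h
      · omega
      · exact hc.1 h
  · convert (hset _ _ 0 h0).1 using 1
    ext p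
    simp
  · intro i hi s' hf hx hinv
    have hs' : s'.var 1 = I.m := by
      refine (hf.1 1 fun h => ?_).trans hs
      rcases List.mem_cons.1 h with h | h
      · omega
      · rcases hv 1 h with h | h
        · omega
        · exact hc.1 h
    refine .mono (.for_loop (M := I.m)
      (fun j => Inv {p | (p.1 : ℕ) < i ∨ (p.1 : ℕ) = i ∧ (p.2 : ℕ) < j}) hm hc.2.2 ?_ ?_ ?_) ?_
    · intro s'' hf'
      refine (hf'.1 1 fun h => ?_).trans hs'
      rcases List.mem_cons.1 h with h | h
      · omega
      · exact hc.1 h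
    · convert (hset _ _ 0 hinv).2 using 1
      ext p
      simp
    · intro j hj s'' hf' hx' hinv'
      have h7 : s''.var 7 = i := by
        refine (hf'.1 7 fun h => ?_).trans hx
        rcases List.mem_cons.1 h with h | h
        · omega
        · exact hc.2.1 h
      refine .mono (step _ ⟨i, hi⟩ ⟨j, hj⟩ s'' h7 hx' hinv') fun s₃ _ h₃ => ?_
      convert (hset _ _ (j + 1) h₃).2 using 1
      ext ⟨a, b⟩
      simp only [Set.mem_ofPred_eq, Set.mem_insert_iff, Prod.mk.injEq, Fin.ext_iff]
      omega
    · intro s'' _ h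
      convert (hset _ _ (i + 1) h).1 using 1
      ext ⟨a, b⟩
      simp only [Set.mem_ofPred_eq]
      omega
  · intro s' _ h
    convert h using 1
    ext p
    simp

/-- Every 2-cut is the side of some pair of edges, so it suffices to treat these sides. -/
theorem covered_of_sides (hG : I.inst.graph.IsCactus) {st : Fin (I.k + I.k) → ℕ}
    (h : ∀ e f, (I.side e f).Nonempty → I.Covered st (I.side e f)) {C : Finset (Fin I.n)}
    (hC : I.inst.IsTwoCut C) : I.Covered st C := by
  obtain ⟨e, f, rfl⟩ := hC.exists_eq_side hG
  exact h e f hC.nonempty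

theorem runs_stampLeaving (hk : I.k + I.k ≤ N) (hs : Holds I s) {e f : Fin I.m}
    (hS : HoldsSet I s (I.side e f)ᶜ) {st : Fin (I.k + I.k) → ℕ} (hst : HoldsStamps I s st) {q : ℕ}
    (hq : s.var 5 = q) :
    Runs N stampLeaving s fun s' => HoldsStamps I s' fun a =>
      if I.arcs.Leaves a (I.side e f) then q else st a := by
  refine .mono (.for_loop (M := I.k + I.k) (fun i s' => HoldsStamps I s' fun a =>
    if (a : ℕ) < i ∧ I.arcs.Leaves a (I.side e f) then q else st a) hk (by decide) ?_ ?_ ?_) ?_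
  · intro s' hf
    exact (hf.1 4 (by decide)).trans hs.arcs
  · intro a
    simpa using hst a
  · intro i hi s' hf hx hinv
    have hs' := hs.frame hf (by decide) (by decide)
    have hS' : HoldsSet I s' (I.side e f)ᶜ := by
      intro v
      rw [hf.2 6 (by decide)]
      exact hS v
    have hl := eval_leaves hs' hS' ⟨i, hi⟩
    refine .guarded (fun h => .store fun a => ?_) fun h a => ?_
    · have hl' : I.arcs.Leaves ⟨i, hi⟩ (I.side e f) := by
        by_contra hn
        rw [if_neg hn] at hl
        exact h (by simpa [Expr.eval, hx] using hl)
      have ha := hinv a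
      simp only [Expr.eval, hx, Memory.setVar_arr, Memory.setArr_arr, true_and, ha,
        (hf.1 5 (by decide)).trans hq]
      by_cases hai : (a : ℕ) = i
      · obtain rfl : a = ⟨i, hi⟩ := Fin.ext hai
        simp [hl']
      · have : (a : ℕ) < i + 1 ↔ (a : ℕ) < i := by omega
        simp [hai, this]
    · have hl' : ¬ I.arcs.Leaves ⟨i, hi⟩ (I.side e f) := by
        intro hn
        rw [if_pos hn] at hl
        simp only [Expr.eval, hx] at h
        simp only at hl
        omega
      have ha := hinv a
      rw [Memory.setVar_arr, ha]
      by_cases hai : (a : ℕ) = i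
      · obtain rfl : a = ⟨i, hi⟩ := Fin.ext hai
        simp [hl']
      · have : (a : ℕ) < i + 1 ↔ (a : ℕ) < i := by omega
        simp only [this]
  · intro s' _ h a
    simpa using h a

/-! ### The dual phase -/

/-- The invariant of the dual phase: the sets of size at most `σ` are covered, and so are the sets
of size `σ + 1` that belong to a pair of edges in `P`. -/
def DualInv (I : AugInput) (σ : ℕ) (P : Set (Fin I.m × Fin I.m)) (s : Memory) : Prop :=
  ∃ st q D, Holds I s ∧ s.var 5 = q ∧ HoldsStamps I s st ∧
    Stamped I.arcs I.inst.IsTwoCut I.markedArc st q D ∧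
    (∀ C, I.inst.IsTwoCut C → C.card ≤ σ → I.Covered st C) ∧
    ∀ e f, (e, f) ∈ P → (I.side e f).card = σ + 1 → I.Covered st (I.side e f)

theorem Holds.setVar (h : Holds I s) {x y : ℕ} (hx : 5 ≤ x) : Holds I (s.setVar x y) :=
  h.frame (.setVar (.refl [x] [] s) (by simp)) (by simp; omega) (by simp)

theorem DualInv.setVar {σ : ℕ} {P : Set (Fin I.m × Fin I.m)} (h : DualInv I σ P s) {x y : ℕ}
    (hx : 6 ≤ x) : DualInv I σ P (s.setVar x y) := by
  obtain ⟨st, q, D, h1, h2, h3, h4⟩ := h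
  refine ⟨st, q, D, h1.setVar (by omega), ?_, h3, h4⟩
  rw [Memory.setVar_var, if_neg (by omega)]
  exact h2

theorem runs_choose (hn : I.n ≤ N) (hm : I.m ≤ N) (hk : I.k + I.k ≤ N)
    (hG : I.inst.graph.IsCactus) (hfeas : I.inst.IsFeasible) {σ : ℕ}
    {P : Set (Fin I.m × Fin I.m)} {e f : Fin I.m} (h6 : s.var 6 = σ) (he : s.var 7 = e)
    (hf : s.var 8 = f) (h : DualInv I σ P s) : Runs N choose s (DualInv I σ (insert (e, f) P)) := by
  obtain ⟨st, q, D, hs, hq, hst, hSt, hsmall, hP⟩ := h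
  refine .seq (.mono (runs_scan hn hm hk hs he hf hst) ?_)
  rintro s₁ hf₁ ⟨hS, hcard, hcov⟩
  have hs₁ := hs.frame hf₁ (by decide) (by decide)
  have hst₁ : HoldsStamps I s₁ st := fun a => by rw [hf₁.2 9 (by decide)]; exact hst a
  have hq₁ : s₁.var 5 = q := (hf₁.1 5 (by decide)).trans hq
  have h6₁ : s₁.var 6 = σ := (hf₁.1 6 (by decide)).trans h6
  -- The test asks for the right size and for an uncovered side.
  have htest : (Expr.sub (.const 1) (.add (.dist (.var 11) (.add (.var 6) (.const 1)))
      (.var 12))).eval s₁ ≠ 0 ↔ (I.side e f).card = σ + 1 ∧ ¬ I.Covered st (I.side e f) := by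
    have hd := eval_dist (s := s₁) (x := .var 11) (y := .add (.var 6) (.const 1))
    rw [← hcov]
    simp only [Expr.eval, hcard, h6₁] at hd ⊢
    omega
  refine .guarded (fun hc => .seq (.assign ?_)) fun hc => ?_
  · obtain ⟨hsize, hunc⟩ := htest.1 hc
    have hC : I.inst.IsTwoCut (I.side e f) :=
      RootedAug.isTwoCut_side hG (Finset.card_pos.1 (hsize ▸ Nat.succ_pos σ))
    have hs₂ : Holds I (s₁.setVar 5 (Expr.eval s₁ (.add (.var 5) (.const 1)))) :=
      hs₁.setVar le_rfl
    refine .mono (runs_stampLeaving (q := q + 1) hk hs₂ hS hst₁ (by simp [Expr.eval, hq₁])) ?_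
    intro s₃ hf₃ h₃
    refine ⟨_, q + 1, _, hs₂.frame hf₃ (by decide) (by decide), ?_, h₃,
      hSt.step hC (fun a ha hl => hunc ⟨a, ha, hl⟩) fun C' hC' hlt =>
        hsmall C' hC' (by have := Finset.card_lt_card hlt; omega), ?_, ?_⟩
    · rw [hf₃.1 5 (by decide)]
      simp [Expr.eval, hq₁]
    -- Stamping keeps nonzero stamps nonzero, so what was covered remains covered.
    · intro C h1 h2
      obtain ⟨a, ha, hl⟩ := hsmall C h1 h2
      exact ⟨a, by dsimp only; split_ifs <;> simp [ha], hl⟩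
    · intro e' f' hef h2
      rcases hef with hef | hef
      · obtain ⟨rfl, rfl⟩ := Prod.mk.inj hef
        obtain ⟨a, hl⟩ := I.orients.exists_leaves_of_isFeasible hfeas hC
        exact ⟨a, by simp [hl], hl⟩
      · obtain ⟨a, ha, hl⟩ := hP e' f' hef h2
        exact ⟨a, by dsimp only; split_ifs <;> simp [ha], hl⟩
  · have hc' := mt htest.2 (not_not.2 hc)
    refine ⟨st, q, D, hs₁, hq₁, hst₁, hSt, hsmall, fun e' f' hef h2 => ?_⟩
    rcases hef with hef | hef
    · obtain ⟨rfl, rfl⟩ := Prod.mk.inj hef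
      by_contra hn
      exact hc' ⟨h2, hn⟩
    · exact hP e' f' hef h2

theorem runs_dualPhase (hn : I.n ≤ N) (hm : I.m ≤ N) (hk : I.k + I.k ≤ N)
    (hG : I.inst.graph.IsCactus) (hfeas : I.inst.IsFeasible) (hs : Holds I s) (h5 : s.var 5 = 1)
    (hst : HoldsStamps I s fun a => if I.markedArc a then 1 else 0) :
    Runs N dualPhase s fun s' => ∃ st q D, Holds I s' ∧ s'.var 5 = q ∧ HoldsStamps I s' st ∧
      Stamped I.arcs I.inst.IsTwoCut I.markedArc st q D ∧
      ∀ C, I.inst.IsTwoCut C → I.Covered st C := by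
  refine .mono (.for_loop (M := I.n) (fun σ => DualInv I σ ∅) hn (by decide) ?_ ?_ ?_) ?_
  · intro s' hf
    exact (hf.1 0 (by decide)).trans hs.n
  · refine DualInv.setVar ⟨_, 1, fun _ => ∅, hs, h5, hst, Stamped.initial (fun a => ?_)
      (fun a => ?_), fun C hC hc => ?_, fun e f h => h.elim⟩ le_rfl
    · split_ifs <;> simp
    · simp
    · have := hC.nonempty.card_pos
      omega
  · intro σ hσ s' hf hx hinv
    have hs' : s'.var 1 = I.m := (hf.1 1 (by decide)).trans hs.m
    refine .mono (runs_forPairs (fun P s'' => s''.var 6 = σ ∧ DualInv I σ P s'') hm (by decide)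
      hs' ?_ ⟨hx, hinv⟩ ?_) ?_
    · rintro P s'' y ⟨h6, hd⟩
      exact ⟨⟨by simpa using h6, hd.setVar (by omega)⟩, ⟨by simpa using h6, hd.setVar (by omega)⟩⟩
    · rintro P e f s'' he hf' ⟨h6, hd⟩
      exact .mono (runs_choose hn hm hk hG hfeas h6 he hf' hd) fun s₃ hf₃ h₃ =>
        ⟨(hf₃.1 6 (by decide)).trans h6, h₃⟩
    · rintro s'' - ⟨-, st, q, D, h1, h2, h3, h4, h5, h6⟩
      refine DualInv.setVar ⟨st, q, D, h1, h2, h3, h4, fun C hC hc => ?_, fun e f h => h.elim⟩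
        le_rfl
      rcases Nat.le_succ_iff.1 hc with hc | hc
      · exact h5 C hC hc
      · obtain ⟨e, f, rfl⟩ := hC.exists_eq_side hG
        exact h6 e f trivial hc
  · rintro s' - ⟨st, q, D, h1, h2, h3, h4, h5, -⟩
    refine ⟨st, q, D, h1, h2, h3, h4, fun C hC => h5 C hC ?_⟩
    simpa using C.card_le_univ

/-- There are at most as many chosen sets as arcs, so the number of stamps is polynomial. -/
theorem stamp_le (hfeas : I.inst.IsFeasible) {st : Fin (I.k + I.k) → ℕ} {q : ℕ}
    {D : ℕ → Finset (Fin I.n)} (h : Stamped I.arcs I.inst.IsTwoCut I.markedArc st q D) :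
    q - 1 ≤ I.k + I.k := by
  have hsub : Finset.Icc 2 q ⊆ Finset.univ.image st := by
    intro i hi
    rw [Finset.mem_Icc] at hi
    obtain ⟨a, ha⟩ := I.orients.exists_leaves_of_isFeasible hfeas (h.mem i hi.1 hi.2)
    exact Finset.mem_image.2 ⟨a, Finset.mem_univ _, (h.eq_iff i hi.1 hi.2 a).2 ha⟩
  have := (Finset.card_le_card hsub).trans Finset.card_image_le
  simp only [Nat.card_Icc, Finset.card_univ, Fintype.card_fin] at this
  omega

/-! ### The pruning phase -/

theorem runs_countUncovered (hn : I.n ≤ N) (hm : I.m ≤ N) (hk : I.k + I.k ≤ N)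
    (hG : I.inst.graph.IsCactus) (hs : Holds I s) (h14 : s.var 14 = 0)
    {st : Fin (I.k + I.k) → ℕ} (hst : HoldsStamps I s st) :
    Runs N countUncovered s fun s' =>
      (s'.var 14 = 0 ↔ ∀ C, I.inst.IsTwoCut C → I.Covered st C) := by
  refine .mono (runs_forPairs (fun P s' => Holds I s' ∧ HoldsStamps I s' st ∧ (s'.var 14 = 0 ↔
    ∀ e f, (e, f) ∈ P → (I.side e f).Nonempty → I.Covered st (I.side e f))) hm (by decide) hs.m
    ?_ ⟨hs, hst, by simp [h14]⟩ ?_) ?_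
  · rintro P s' y ⟨h1, h2, h3⟩
    exact ⟨⟨h1.setVar (by omega), h2, by simpa using h3⟩,
      ⟨h1.setVar (by omega), h2, by simpa using h3⟩⟩
  · rintro P e f s' he hf ⟨h1, h2, h3⟩
    refine .seq (.mono (runs_scan hn hm hk h1 he hf h2) ?_)
    rintro s₁ hf₁ ⟨-, hcard, hcov⟩
    have hs₁ := h1.frame hf₁ (by decide) (by decide)
    have hst₁ : HoldsStamps I s₁ st := fun a => by rw [hf₁.2 9 (by decide)]; exact h2 a
    have h14₁ : s₁.var 14 = s'.var 14 := hf₁.1 14 (by decide)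
    have hins : (∀ e' f', (e', f') ∈ insert (e, f) P → (I.side e' f').Nonempty →
        I.Covered st (I.side e' f')) ↔ (∀ e' f', (e', f') ∈ P → (I.side e' f').Nonempty →
        I.Covered st (I.side e' f')) ∧ ((I.side e f).Nonempty → I.Covered st (I.side e f)) := by
      simp only [Set.mem_insert_iff, Prod.mk.injEq]
      constructor
      · exact fun h => ⟨fun e' f' h' => h e' f' (.inr h'), h e f (.inl ⟨rfl, rfl⟩)⟩
      · rintro ⟨h, h'⟩ e' f' (⟨rfl, rfl⟩ | h'')
        · exact h'
        · exact h e' f' h''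
    refine .guarded (fun hc => .assign ⟨hs₁.setVar (by omega), hst₁, ?_⟩)
      fun hc => ⟨hs₁, hst₁, ?_⟩
    · have hne : (I.side e f).Nonempty := by
        rw [← Finset.card_pos, ← hcard]
        exact Nat.pos_of_ne_zero hc
      have : I.Covered st (I.side e f) ↔ s₁.var 12 ≠ 0 := by rw [Ne, hcov, not_not]
      rw [hins, ← h3]
      simp only [Expr.eval, Memory.setVar_var, if_true, h14₁, hne, true_imp_iff, this]
      omega
    · have hne : ¬ (I.side e f).Nonempty := by
        rw [← Finset.card_pos, ← hcard]
        exact fun h => h.ne' hc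
      rw [hins, ← h3, h14₁]
      simp [hne]
  · rintro s' - ⟨-, -, h⟩
    rw [h]
    exact ⟨fun h' C hC => covered_of_sides hG (fun e f => h' e f trivial) hC,
      fun h' e f _ hne => h' _ (RootedAug.isTwoCut_side hG hne)⟩

/-- The invariant of the pruning phase. -/
def PruneInv (I : AugInput) (st₀ : Fin (I.k + I.k) → ℕ) (q : ℕ) (P : Set (Fin (I.k + I.k)))
    (s : Memory) : Prop :=
  ∃ st, Holds I s ∧ s.var 5 = q ∧ HoldsStamps I s st ∧ Pruned I.arcs I.inst.IsTwoCut st₀ st P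

theorem PruneInv.setVar {st₀ : Fin (I.k + I.k) → ℕ} {q : ℕ} {P : Set (Fin (I.k + I.k))}
    (h : PruneInv I st₀ q P s) {x y : ℕ} (hx : 6 ≤ x) : PruneInv I st₀ q P (s.setVar x y) := by
  obtain ⟨st, h1, h2, h3⟩ := h
  refine ⟨st, h1.setVar (by omega), ?_, h3⟩
  rw [Memory.setVar_var, if_neg (by omega)]
  exact h2

/-- Since the current stamp `q` is positive, arcs that have been removed fail the test. -/
theorem runs_pruneArc (hn : I.n ≤ N) (hm : I.m ≤ N) (hk : I.k + I.k ≤ N)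
    (hG : I.inst.graph.IsCactus) {st₀ : Fin (I.k + I.k) → ℕ} {q : ℕ} (hq : q ≠ 0)
    {P : Set (Fin (I.k + I.k))} {a : Fin (I.k + I.k)} (ha : s.var 13 = a) (haP : st₀ a = q → a ∉ P)
    (hP : ∀ b ∈ P, q ≤ st₀ b) (h : PruneInv I st₀ q P s) :
    Runs N pruneArc s (PruneInv I st₀ q (if st₀ a = q then insert a P else P)) := by
  obtain ⟨st, hs, h5, hst, hpr⟩ := h
  have hsta : st a = q ↔ st₀ a = q :=
    ⟨fun h => by rcases hpr.sub a with h' | h' <;> omega, fun h => (hpr.eq a (haP h)).trans h⟩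
  have htest : (Expr.sub (.const 1) (.dist (.get 9 (.var 13)) (.var 5))).eval s ≠ 0 ↔
      st₀ a = q := by
    have hd := eval_dist (s := s) (x := .get 9 (.var 13)) (y := .var 5)
    simp only [Expr.eval, ha, hst a, h5] at hd ⊢
    omega
  refine .guarded (fun hc => ?_) fun hc => ?_
  · have hq' := htest.1 hc
    rw [if_pos hq']
    refine .seq (.store (.seq (.assign (.seq ?_))))
    set s₁ := (s.setArr 9 (Expr.eval s (.var 13)) (Expr.eval s (.const 0))) with hs₁
    set s₂ := s₁.setVar 14 (Expr.eval s₁ (.const 0)) with hs₂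
    have hfr : Frame [14] [9] s s₂ := by
      refine .setVar ⟨fun _ _ => rfl, fun b hb => ?_⟩ (by decide)
      have hb9 : b ≠ 9 := by simpa using hb
      funext j
      simp [hs₁, hb9]
    have hs2 := hs.frame hfr (by decide) (by decide)
    have hst2 : HoldsStamps I s₂ (Function.update st a 0) := by
      intro b
      simp only [hs₂, hs₁, Memory.setVar_arr, Memory.setArr_arr, Expr.eval, ha, true_and, hst b,
        Function.update_apply, Fin.ext_iff]
    refine .mono (runs_countUncovered hn hm hk hG hs2 (by simp [hs₂, Expr.eval]) hst2) ?_
    intro s₃ hf₃ h₃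
    have hs3 := hs2.frame hf₃ (by decide) (by decide)
    have hst3 : HoldsStamps I s₃ (Function.update st a 0) := fun b => by
      rw [hf₃.2 9 (by decide)]; exact hst2 b
    have h5₃ : s₃.var 5 = q :=
      (hf₃.1 5 (by decide)).trans ((hfr.1 5 (by decide)).trans h5)
    have h13₃ : s₃.var 13 = a :=
      (hf₃.1 13 (by decide)).trans ((hfr.1 13 (by decide)).trans ha)
    refine .guarded (fun hc' => .store ?_) fun hc' => ?_
    · refine ⟨st, hs3.frame (vs := []) (as := [9]) ⟨fun _ _ => rfl, fun b hb => ?_⟩ (by decide)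
        (by decide), h5₃, fun b => ?_, hpr.keep (fun b hb => hq' ▸ hP b hb) (mt h₃.2 hc')⟩
      · have hb9 : b ≠ 9 := by simpa using hb
        funext j
        simp [hb9]
      · have := hst3 b
        simp only [Memory.setArr_arr, Expr.eval, h13₃, h5₃, true_and, this,
          Function.update_apply, ← Fin.ext_iff]
        split_ifs with hb
        · rw [hb, hsta.2 hq']
        · rfl
    · exact ⟨_, hs3, h5₃, hst3, hpr.drop (h₃.1 hc')⟩
  · rw [if_neg (mt htest.2 (not_not.2 hc))]
    exact ⟨st, hs, h5, hst, hpr⟩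

theorem runs_prunePhase (hn : I.n ≤ N) (hm : I.m ≤ N) (hk : I.k + I.k ≤ N)
    (hG : I.inst.graph.IsCactus) {st₀ : Fin (I.k + I.k) → ℕ} {q : ℕ} (hq : 1 ≤ q)
    (hqN : q - 1 ≤ N) (hle : ∀ a, st₀ a ≤ q) (hs : Holds I s) (h5 : s.var 5 = q)
    (hst : HoldsStamps I s st₀) (hcov : ∀ C, I.inst.IsTwoCut C → I.Covered st₀ C) :
    Runs N prunePhase s (PruneInv I st₀ 1 {a | 1 < st₀ a}) := by
  refine .countdown (fun i => PruneInv I st₀ (i + 1) {a | i + 1 < st₀ a}) ?_ ?_ hqN ?_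
  · rintro i s' ⟨st, -, h, -⟩
    simp [Expr.eval, h]
  · intro i s' _ hinv
    refine .seq (.mono (.for_loop (M := I.k + I.k) (fun j => PruneInv I st₀ (i + 2)
      {a | i + 2 < st₀ a ∨ st₀ a = i + 2 ∧ (a : ℕ) < j}) hk (by decide) ?_ ?_ ?_) ?_)
    · intro s'' hf
      obtain ⟨st, h, -⟩ := hinv
      exact (hf.1 4 (by decide)).trans h.arcs
    · convert hinv.setVar (x := 13) (y := 0) (by omega) using 1
      ext a
      simp
    · intro j hj s'' _ hx hinv'
      refine .mono (runs_pruneArc (a := ⟨j, hj⟩) hn hm hk hG (by omega) hx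
        (fun h => by simp [h]) ?_ hinv') ?_
      · intro b hb
        simp only [Set.mem_ofPred_eq] at hb
        omega
      · intro s₃ _ h₃
        convert h₃.setVar (x := 13) (y := j + 1) (by omega) using 1
        ext b
        split_ifs with hc
        · simp only [Set.mem_ofPred_eq, Set.mem_insert_iff, Fin.ext_iff]
          constructor
          · omega
          · rintro (hb | hb)
            · obtain rfl : b = ⟨j, hj⟩ := Fin.ext hb
              omega
            · omega
        · simp only [Set.mem_ofPred_eq]
          refine or_congr_right (and_congr_right fun hb => ?_)
          have : (b : ℕ) ≠ j := by
            intro hbj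
            obtain rfl : b = ⟨j, hj⟩ := Fin.ext hbj
            exact hc hb
          omega
    · rintro s'' - ⟨st, h1, h2, h3, h4⟩
      refine .assign ⟨st, h1.setVar le_rfl, by simp [Expr.eval, h2], h3, ?_⟩
      convert h4 using 1
      ext b
      simp only [Set.mem_ofPred_eq]
      omega
  · refine ⟨st₀, hs, by omega, hst, fun a => .inr rfl, hcov, fun a ha => ?_, fun _ _ => rfl⟩
    have := hle a
    simp only [Set.mem_ofPred_eq] at ha
    omega

theorem runs_writeOutput (hk : I.k ≤ N) (hs : Holds I s) {st : Fin (I.k + I.k) → ℕ}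
    (hst : HoldsStamps I s st) :
    Runs N writeOutput s fun s' => ∀ ℓ, ℓ ∈ I.output s' ↔
      ∃ a, st a ≠ 0 ∧ s(I.arcs.tail a, I.arcs.head a) = ℓ := by
  refine .mono (.for_loop (M := I.k) (fun i s' => ∀ j : Fin I.k, (j : ℕ) < i →
    s'.arr 5 j = st (Fin.castAdd I.k j) + st (Fin.natAdd I.k j)) hk (by decide) ?_
    (fun j hj => by omega) ?_) ?_
  · intro s' hf
    exact (hf.1 2 (by decide)).trans hs.k
  · intro i hi s' hf hx hinv
    have h2 : s'.var 2 = I.k := (hf.1 2 (by decide)).trans hs.k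
    refine .store fun j hj => ?_
    simp only [Memory.setVar_arr, Memory.setArr_arr, Expr.eval, hx, h2, true_and]
    split_ifs with hji
    · rw [← hst, ← hst, hf.2 9 (by decide), ← hji]
      rfl
    · exact hinv j (by omega)
  · intro s' _ h ℓ
    simp only [output, Finset.mem_image, Finset.mem_filter, Finset.mem_univ, true_and]
    constructor
    · rintro ⟨i, hi, rfl⟩
      rw [h i i.2] at hi
      by_cases h0 : st (Fin.castAdd I.k i) = 0
      · exact ⟨_, by omega, link_natAdd i⟩
      · exact ⟨_, h0, link_castAdd i⟩
    · rintro ⟨a, ha, rfl⟩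
      induction a using Fin.addCases with
      | left i => exact ⟨i, by rw [h i i.2]; omega, (link_castAdd i).symm⟩
      | right i => exact ⟨i, by rw [h i i.2]; omega, (link_natAdd i).symm⟩

end AugInput

theorem mainTheorem5 :
    ∃ (P : RAM.Prog) (p : Polynomial ℕ), ∀ I : AugInput,
      I.inst.IsCacAP → I.inst.IsLeafToLeafPlus → I.inst.IsFeasible →
      I.inst.IsLeafMatching I.matching → (∀ ℓ ∈ I.matching, ¬ I.inst.IsBad ℓ) →
      ∃ (t : ℕ) (s : RAM.Memory), RAM.Exec P I.memory t s ∧ t ≤ p.eval I.size ∧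
        I.inst.IsSolution (I.output s) ∧ I.matching ⊆ I.output s ∧
        ((I.output s).card : ℚ) ≤
          (I.matching.card : ℚ) + 1 / 2 * ((I.inst.inLinks I.matching).card : ℚ)
            + ((I.inst.graph.leaves.card : ℚ) - 2 * (I.matching.card : ℚ)) := by
  refine ⟨RAM.augment, RAM.augment.timePoly.comp (2 * Polynomial.X), ?_⟩
  intro I hI hleaf hfeas hM hbad
  -- No loop is iterated more than `2 * I.size` times in a row.
  have hn : I.n ≤ 2 * I.size := by simp only [AugInput.size]; omega
  have hm : I.m ≤ 2 * I.size := by simp only [AugInput.size]; omega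
  have hk : I.k + I.k ≤ 2 * I.size := by simp only [AugInput.size]; omega
  have hruns : RAM.Runs (2 * I.size) RAM.augment I.memory fun s =>
      I.inst.IsSolution (I.output s) ∧ I.matching ⊆ I.output s ∧
        ((I.output s).card : ℚ) ≤
          (I.matching.card : ℚ) + 1 / 2 * ((I.inst.inLinks I.matching).card : ℚ)
            + ((I.inst.graph.leaves.card : ℚ) - 2 * (I.matching.card : ℚ)) := by
    refine .seq (.mono (AugInput.runs_initArcs (by omega)) ?_)
    rintro s₁ - ⟨hs₁, h5₁, hst₁⟩
    refine .seq (.mono (AugInput.runs_dualPhase hn hm hk hI.1 hfeas hs₁ h5₁ hst₁) ?_)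
    rintro s₂ - ⟨st₀, q, D, hs₂, h5₂, hst₂, hSt, hcov⟩
    have hq := AugInput.stamp_le hfeas hSt
    refine .seq (.mono (AugInput.runs_prunePhase hn hm hk hI.1 hSt.one_le (by omega) hSt.le hs₂
      h5₂ hst₂ hcov) ?_)
    rintro s₃ - ⟨st, hs₃, -, hst₃, hpr⟩
    refine .mono (AugInput.runs_writeOutput (by omega) hs₃ hst₃) fun s₄ _ h₄ => ?_
    refine RootedAug.isSolution_and_card_le hI hleaf hfeas hM hbad I.orients hSt hpr.sub
      (fun a ha => ?_) hpr.cover (fun a ha => hpr.settled a (by simp; omega)) h₄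
    have h1 := (hSt.eq_one_iff a).2 ha
    rw [hpr.eq a (by simp [h1]), h1]
    exact one_ne_zero
  obtain ⟨t, s, he, ht, hs⟩ := hruns
  refine ⟨t, s, he, ?_, hs⟩
  simpa using ht
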